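/- A digraph $\Gamma$ is a vertex set $V\Gamma$ (of any cardinality) with a set of arcs $E\Gamma\subseteq V\Gamma\times V\Gamma$; $\mathrm{Aut}(\Gamma)$ is the group of bijections of $V\Gamma$ that preserve arcs in both directions. Connectedness, paths and rays (one-way infinite paths with distinct vertices) ignore the orientation of arcs. Two rays are equivalent if there are infinitely many pairwise disjoint paths, each starting on the first ray and ending on the second; the ends of $\Gamma$ are the equivalence classes of rays, and $\Gamma$ is two-ended if it is connected and has exactly two ends. For $N\le\mathrm{Aut}(\Gamma)$, the vertices of $\Gamma/N$ are the $N$-orbits on $V\Gamma$, and $(A,B)$ is an arc of $\Gamma/N$ if $\Gamma$ has an arc from a vertex of $A$ to a vertex of $B$. Let $\mathbb{Z}$ also denote the digraph on the integers with arcs $(i,i+1)$ and $(i+1,i)$ for all $i$, and $\vec{\mathbb{Z}}$ the digraph on the integers with arcs $(i,i+1)$ only. A connected digraph has Property Z if it admits a surjective digraph homomorphism onto $\vec{\mathbb{Z}}$. A digraph is $2$-arc-transitive if its automorphism group is transitive on the triples $(v_0,v_1,v_2)$ with $(v_0,v_1)$ and $(v_1,v_2)$ arcs. Let $\Gamma$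 be a vertex-transitive, arc-transitive, two-ended digraph and $G=\mathrm{Aut}(\Gamma)$. Then $G$ contains a normal subgroup $N$ with finite orbits on $V\Gamma$ such that either (i) $\Gamma/N\cong\mathbb{Z}$ and $G/N\cong D_\infty$, the infinite dihedral group; or (ii) $\Gamma/N\cong\vec{\mathbb{Z}}$ and $G/N\cong\mathbb{Z}$. Moreover, for every normal subgroup $N$ of $G$ with finite orbits on $V\Gamma$ for which (i) or (ii) holds: $\Gamma$ has Property Z in case (ii) but not in case (i); if $\Gamma$ is $2$-arc-transitive, then (ii) holds; in case (i) $G$ acts transitively on the ends of $\Gamma$; and in case (ii) $G$ acts trivially on the ends of $\Gamma$. -/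

import Mathlib

/-! Digraphs are Mathlib's `Digraph V`: an arbitrary (not necessarily symmetric, possibly with loops)
binary relation `Adj` on a vertex type `V`. -/

namespace Digraph

universe u

variable {V : Type u}

/-- The automorphism group `Aut(Γ)`: bijections of the vertex set that preserve arcs in both
directions. Its group structure is composition, and it acts on `V` by evaluation. -/
abbrev Aut (Γ : Digraph V) : Type u := Γ.Adj ≃r Γ.Adj

/-- `Aut(Γ)` is transitive on vertices. -/
def VertexTransitive (Γ : Digraph V) : Prop :=
  ∀ v w : V, ∃ g : Γ.Aut, g v = w

/-- `Aut(Γ)` is transitive on arcs. -/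
def ArcTransitive (Γ : Digraph V) : Prop :=
  ∀ v w v' w' : V, Γ.Adj v w → Γ.Adj v' w' → ∃ g : Γ.Aut, g v = v' ∧ g w = w'

/-- A `k`-arc: a sequence of `k + 1` vertices, each joined to the next by an arc. -/
def IsKArc (Γ : Digraph V) (k : ℕ) (p : Fin (k + 1) → V) : Prop :=
  ∀ i : Fin k, Γ.Adj (p i.castSucc) (p i.succ)

/-- `Aut(Γ)` is transitive on `k`-arcs. -/
def KArcTransitive (Γ : Digraph V) (k : ℕ) : Prop :=
  ∀ p q : Fin (k + 1) → V, Γ.IsKArc k p → Γ.IsKArc k q → ∃ g : Γ.Aut, ∀ i, g (p i) = q i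

/-- The digraph homomorphisms from `Γ` to `Δ`. -/
def IsHom {W : Type*} (Γ : Digraph V) (Δ : Digraph W) (φ : V → W) : Prop :=
  ∀ v w : V, Γ.Adj v w → Δ.Adj (φ v) (φ w)

/-- Two digraphs are isomorphic. -/
def Isomorphic {W : Type*} (Γ : Digraph V) (Δ : Digraph W) : Prop :=
  Nonempty (Γ.Adj ≃r Δ.Adj)

/-- The underlying undirected simple graph: distinct vertices are adjacent when there is an arc
between them in at least one direction. -/
abbrev underlying (Γ : Digraph V) : SimpleGraph V := Γ.toSimpleGraphInclusive

/-- Connectedness of a digraph ignores the direction of the arcs. -/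
def IsConnected (Γ : Digraph V) : Prop := Γ.underlying.Connected

/-- The directed line: arcs `(i, i + 1)` for `i : ℤ`. -/
def directedLine : Digraph ℤ where
  Adj i j := j = i + 1

/-- The undirected line as a digraph: arcs `(i, i + 1)` and `(i + 1, i)` for `i : ℤ`. -/
def undirectedLine : Digraph ℤ where
  Adj i j := j = i + 1 ∨ i = j + 1

/-- Property Z: connected, with a surjective digraph homomorphism onto the directed line. -/
def PropertyZ (Γ : Digraph V) : Prop :=
  Γ.IsConnected ∧ ∃ φ : V → ℤ, Function.Surjective φ ∧ Γ.IsHom directedLine φ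

/-- The quotient of `Γ` by an equivalence relation: there is an arc from the class `A` to the class
`B` if there is an arc of `Γ` from some vertex of `A` to some vertex of `B`. -/
def quotient (Γ : Digraph V) (s : Setoid V) : Digraph (Quotient s) where
  Adj A B := ∃ v w : V, Quotient.mk s v = A ∧ Quotient.mk s w = B ∧ Γ.Adj v w

/-- `Γ / N`, whose vertices are the orbits of `N` on the vertices of `Γ`. -/
def orbitQuotient (Γ : Digraph V) (N : Subgroup Γ.Aut) : Digraph (MulAction.orbitRel.Quotient N V) :=
  Γ.quotient (MulAction.orbitRel N V)

/-- `N` has finite orbits on the vertex set. -/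
def HasFiniteOrbits (Γ : Digraph V) (N : Subgroup Γ.Aut) : Prop :=
  ∀ v : V, (MulAction.orbit N v).Finite

/-- `Γ / N` is the undirected line and `Aut(Γ) / N` is the infinite dihedral group
(which is Mathlib's `DihedralGroup 0`). -/
def UndirectedCase (Γ : Digraph V) (N : Subgroup Γ.Aut) [N.Normal] : Prop :=
  (Γ.orbitQuotient N).Isomorphic undirectedLine ∧ Nonempty (Γ.Aut ⧸ N ≃* DihedralGroup 0)

/-- `Γ / N` is the directed line and `Aut(Γ) / N` is the infinite cyclic group. -/
def DirectedCase (Γ : Digraph V) (N : Subgroup Γ.Aut) [N.Normal] : Prop :=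
  (Γ.orbitQuotient N).Isomorphic directedLine ∧ Nonempty (Γ.Aut ⧸ N ≃* Multiplicative ℤ)

/-! ### Ends -/

/-- A ray: a one-way infinite path, with distinct vertices, in which the arcs may be traversed in
either direction. -/
structure Ray (Γ : Digraph V) where
  /-- The `n`-th vertex of the ray. -/
  vert : ℕ → V
  inj : Function.Injective vert
  adj : ∀ n, Γ.underlying.Adj (vert n) (vert (n + 1))

/-- Two rays are equivalent if there are infinitely many pairwise disjoint paths (possibly of
length zero) that start on the first ray and end on the second. -/
def RayEquiv (Γ : Digraph V) (R S : Γ.Ray) : Prop :=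
  ∃ (a b : ℕ → V) (p : ∀ n, Γ.underlying.Path (a n) (b n)),
    (∀ n, a n ∈ Set.range R.vert) ∧ (∀ n, b n ∈ Set.range S.vert) ∧
      ∀ m n, m ≠ n → List.Disjoint (p m).1.support (p n).1.support

/-- Two rays are equivalent iff no finite set of vertices separates them. -/
theorem rayEquiv_iff (Γ : Digraph V) (R S : Γ.Ray) :
    Γ.RayEquiv R S ↔ ∀ F : Finset V, ∃ (i j : ℕ) (p : Γ.underlying.Walk (R.vert i) (S.vert j)),
      ∀ x ∈ p.support, x ∉ F := by
  classical
  constructor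
  · rintro ⟨a, b, p, ha, hb, hd⟩ F
    by_contra! hcon
    have key : ∀ n, ∃ x ∈ (p n).1.support, x ∈ F := by
      intro n
      obtain ⟨i, hi⟩ := ha n
      obtain ⟨j, hj⟩ := hb n
      obtain ⟨x, hx, hxF⟩ := hcon i j ((p n).1.copy hi.symm hj.symm)
      exact ⟨x, by simpa using hx, hxF⟩
    choose f hf hfF using key
    have hinj : Function.Injective f := by
      intro m n hmn
      by_contra hne
      exact hd m n hne (hf m) (hmn ▸ hf n)
    exact Set.infinite_of_injective_forall_mem hinj (s := (F : Set V)) (by simpa using hfF)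
      F.finite_toSet
  · intro h
    have : Std.Symm (fun q r : Σ i : ℕ × ℕ, Γ.underlying.Path (R.vert i.1) (S.vert i.2) =>
        List.Disjoint q.2.1.support r.2.1.support) := ⟨fun _ _ hqr => hqr.symm⟩
    obtain ⟨f, -, hf⟩ := exists_seq_of_forall_finset_exists'
      (α := Σ i : ℕ × ℕ, Γ.underlying.Path (R.vert i.1) (S.vert i.2))
      (fun _ => True) (fun q r => List.Disjoint q.2.1.support r.2.1.support)
      (by
        intro s _
        obtain ⟨i, j, p, hp⟩ := h (s.biUnion fun q => q.2.1.support.toFinset)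
        refine ⟨⟨(i, j), p.toPath⟩, trivial, fun q hq x hx hx' => ?_⟩
        refine hp x (SimpleGraph.Walk.support_toPath_subset_support p hx') ?_
        exact Finset.mem_biUnion.2 ⟨q, hq, by simpa using hx⟩)
    exact ⟨_, _, fun n => (f n).2, fun n => ⟨_, rfl⟩, fun n => ⟨_, rfl⟩, fun m n hmn => hf hmn⟩

/-- Two vertices of a ray are joined by the segment of the ray between them. -/
theorem Ray.exists_walk_of_le {Γ : Digraph V} (R : Γ.Ray) {i j : ℕ} (hij : i ≤ j) :
    ∃ p : Γ.underlying.Walk (R.vert i) (R.vert j), ∀ x ∈ p.support, ∃ k, i ≤ k ∧ R.vert k = x := by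
  induction j, hij using Nat.le_induction with
  | base => exact ⟨.nil, fun x hx => ⟨i, le_rfl, by simpa [eq_comm] using hx⟩⟩
  | succ j hij ih =>
    obtain ⟨p, hp⟩ := ih
    refine ⟨p.concat (R.adj j), fun x hx => ?_⟩
    rw [SimpleGraph.Walk.support_concat, List.mem_append, List.mem_singleton] at hx
    rcases hx with hx | rfl
    · exact hp x hx
    · exact ⟨j + 1, by omega, rfl⟩

theorem rayEquiv_symm (Γ : Digraph V) {R S : Γ.Ray} (h : Γ.RayEquiv R S) : Γ.RayEquiv S R := by
  rw [rayEquiv_iff] at h ⊢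
  intro F
  obtain ⟨i, j, p, hp⟩ := h F
  exact ⟨j, i, p.reverse, fun x hx => hp x (by simpa using hx)⟩

theorem rayEquiv_trans (Γ : Digraph V) {R S T : Γ.Ray} (h₁ : Γ.RayEquiv R S)
    (h₂ : Γ.RayEquiv S T) : Γ.RayEquiv R T := by
  classical
  rw [rayEquiv_iff] at h₁ h₂ ⊢
  intro F
  obtain ⟨n, hn⟩ : ∃ n, ∀ k, n ≤ k → S.vert k ∉ F := by
    have hfin : (S.vert ⁻¹' (F : Set V)).Finite := F.finite_toSet.preimage S.inj.injOn
    obtain ⟨n, hn⟩ := hfin.bddAbove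
    exact ⟨n + 1, fun k hk hkF => by have := hn (show k ∈ S.vert ⁻¹' (F : Set V) from hkF); omega⟩
  let F' := F ∪ (Finset.range n).image S.vert
  have hge : ∀ k, S.vert k ∉ F' → n ≤ k := by
    intro k hk
    by_contra hlt
    exact hk (Finset.mem_union_right _ (Finset.mem_image_of_mem _ (Finset.mem_range.2 (by omega))))
  obtain ⟨i, j, p, hp⟩ := h₁ F'
  obtain ⟨k, l, q, hq⟩ := h₂ F'
  have hj : n ≤ j := hge j (hp _ p.end_mem_support)
  have hk : n ≤ k := hge k (hq _ q.start_mem_support)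
  obtain ⟨r, hr⟩ : ∃ r : Γ.underlying.Walk (S.vert j) (S.vert k), ∀ x ∈ r.support, x ∉ F := by
    rcases le_total j k with hjk | hjk
    · obtain ⟨r, hr⟩ := S.exists_walk_of_le hjk
      refine ⟨r, fun x hx => ?_⟩
      obtain ⟨m, hm, rfl⟩ := hr x hx
      exact hn m (by omega)
    · obtain ⟨r, hr⟩ := S.exists_walk_of_le hjk
      refine ⟨r.reverse, fun x hx => ?_⟩
      obtain ⟨m, hm, rfl⟩ := hr x (by simpa using hx)
      exact hn m (by omega)
  refine ⟨i, l, (p.append r).append q, fun x hx => ?_⟩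
  rw [SimpleGraph.Walk.mem_support_append_iff, SimpleGraph.Walk.mem_support_append_iff] at hx
  rcases hx with (hx | hx) | hx
  · exact fun hF => hp x hx (Finset.mem_union_left _ hF)
  · exact hr x hx
  · exact fun hF => hq x hx (Finset.mem_union_left _ hF)

theorem rayEquiv_refl (Γ : Digraph V) (R : Γ.Ray) : Γ.RayEquiv R R :=
  ⟨R.vert, R.vert, fun _ => SimpleGraph.Path.nil, fun n => ⟨n, rfl⟩, fun n => ⟨n, rfl⟩,
    fun m n hmn x hx hx' => hmn (R.inj (by
      have h₁ : x = R.vert m := by simpa using hx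
      have h₂ : x = R.vert n := by simpa using hx'
      exact h₁.symm.trans h₂))⟩

/-- Equivalence of rays as a setoid. -/
def raySetoid (Γ : Digraph V) : Setoid Γ.Ray where
  r := Γ.RayEquiv
  iseqv := ⟨Γ.rayEquiv_refl, Γ.rayEquiv_symm, Γ.rayEquiv_trans⟩

/-- The ends of a digraph: equivalence classes of rays. -/
def Ends (Γ : Digraph V) : Type u := Quotient Γ.raySetoid

/-- A digraph is two-ended if it is connected and has exactly two ends. -/
def TwoEnded (Γ : Digraph V) : Prop := Γ.IsConnected ∧ Nat.card Γ.Ends = 2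

/-- An automorphism as a homomorphism of the underlying graph. -/
def Aut.underlyingHom {Γ : Digraph V} (g : Γ.Aut) : Γ.underlying →g Γ.underlying where
  toFun := g
  map_rel' {v w} h := by
    rw [underlying, toSimpleGraphInclusive, SimpleGraph.fromRel_adj] at h ⊢
    exact ⟨g.injective.ne h.1, h.2.imp g.map_rel_iff.2 g.map_rel_iff.2⟩

/-- The image of a ray under an automorphism. -/
def Aut.mapRay {Γ : Digraph V} (g : Γ.Aut) (R : Γ.Ray) : Γ.Ray where
  vert n := g (R.vert n)
  inj := g.injective.comp R.inj
  adj n := g.underlyingHom.map_adj (R.adj n)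

theorem Aut.mapRay_equiv {Γ : Digraph V} (g : Γ.Aut) {R S : Γ.Ray} (h : Γ.RayEquiv R S) :
    Γ.RayEquiv (g.mapRay R) (g.mapRay S) := by
  classical
  rw [rayEquiv_iff] at h ⊢
  intro F
  obtain ⟨i, j, p, hp⟩ := h (F.image g.symm)
  refine ⟨i, j, p.map g.underlyingHom, fun x hx hxF => ?_⟩
  have hx' : x ∈ p.support.map g.underlyingHom :=
    (congrArg (x ∈ ·) (SimpleGraph.Walk.support_map g.underlyingHom p)).mp hx
  obtain ⟨y, hy, rfl⟩ := List.mem_map.1 hx'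
  exact hp y hy (Finset.mem_image.2 ⟨_, hxF, g.symm_apply_apply y⟩)

/-- The action of the automorphism group on the ends. -/
instance endsAction (Γ : Digraph V) : MulAction Γ.Aut Γ.Ends where
  smul g := Quotient.map g.mapRay fun _ _ h => g.mapRay_equiv h
  one_smul e := Quotient.inductionOn e fun _ => rfl
  mul_smul _ _ e := Quotient.inductionOn e fun _ => rfl

end Digraph

/-! Let E be the subgroup of G that fixes both ends; its index is at most 2. Among the vertex sets
with finite outer boundary that separate the two ends, consider those with the fewest boundary
vertices, the minimum cuts. Submodularity makes them closed under intersection and union, and by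
vertex-transitivity every vertex lies on the boundary of one. Since there are only finitely many
separators of least size, any two minimum cuts differ by finite sets (`IsMinCut.finite_diff`). Local
finiteness is not assumed; it follows from this and arc-transitivity (`EndPair.finite_neighborSet`).

Hence, for a minimum cut A, the number τ(g) = |A \ gA| - |gA \ A| is a homomorphism from E to ℤ, and
conjugation by an automorphism that swaps the ends negates it. If g moves a vertex far, then A and
gA are strictly nested and τ(g) ≠ 0. So the kernel N has finite orbits and the image is infinite
cyclic (`exists_isTranslation`). The group E is vertex-transitive even when it is not G
(`smul_surjective_of_notMem`), so τ descends to a height V → ℤ whose fibres are the N-orbits. Arcs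
change the height by a fixed amount up to sign, and connectedness forces that amount to be ±1. This
identifies Γ/N, and G/N is ℤ or D_∞ according to whether G = E.

For an arbitrary N as in (i) or (ii), the quotient map to the line is again a height. A homomorphism
onto the directed line induces a map G → ℤ trivial on N, and D_∞ has no nontrivial map to ℤ. The
2-arcs over 0, 1, 0 and 0, 1, 2 are inequivalent. The sets of height at least i tell the ends apart,
and G acts on heights by translations in case (ii), while in case (i) some element reverses them. -/

namespace SimpleGraph

/-! ### Vertex cuts, minimum cuts and submodularity. -/

variable {V : Type*} (X : SimpleGraph V)

/-- The vertices outside `A` that are adjacent to a vertex of `A`. -/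
def outerBoundary (A : Set V) : Set V := {y | y ∉ A ∧ ∃ x ∈ A, X.Adj x y}

/-- The vertices that are neither in `A` nor adjacent to a vertex of `A`. -/
def outerSide (A : Set V) : Set V := (A ∪ X.outerBoundary A)ᶜ

variable {X}

theorem mem_outerSide {A : Set V} {x : V} :
    x ∈ X.outerSide A ↔ x ∉ A ∧ x ∉ X.outerBoundary A := by
  simp [outerSide]

theorem Connected.eq_of_forall_adj {α : Type*} (hX : X.Connected) {f : V → α}
    (h : ∀ x y, X.Adj x y → f x = f y) (x y : V) : f x = f y := by
  obtain ⟨w⟩ := hX.preconnected x y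
  induction w with
  | nil => rfl
  | cons hadj _ ih => exact (h _ _ hadj).trans ih

theorem Walk.mem_of_disjoint_outerBoundary {A : Set V} {x y : V} (w : X.Walk x y) (hx : x ∈ A)
    (hw : ∀ z ∈ w.support, z ∉ X.outerBoundary A) : y ∈ A := by
  induction w with
  | nil => exact hx
  | cons hadj p ih =>
    refine ih ?_ fun z hz => hw z (by simp [hz])
    by_contra hv
    exact hw _ (by simp) ⟨hv, _, hx, hadj⟩

theorem Connected.eq_empty_or_univ (hX : X.Connected) {A : Set V}
    (hA : X.outerBoundary A = ∅) : A = ∅ ∨ A = Set.univ := by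
  rcases A.eq_empty_or_nonempty with h | ⟨x, hx⟩
  · exact .inl h
  · refine .inr (Set.eq_univ_of_forall fun y => ?_)
    obtain ⟨w⟩ := hX.preconnected x y
    exact w.mem_of_disjoint_outerBoundary hx (by simp [hA])

/-- This is why the opposite side of a cut is `outerSide A` and not `Aᶜ`: the outer boundary of `Aᶜ`
is the inner boundary of `A`, whose size is not controlled. -/
theorem outerBoundary_outerSide_subset (A : Set V) :
    X.outerBoundary (X.outerSide A) ⊆ X.outerBoundary A := by
  rintro y ⟨hy, x, hx, hxy⟩
  rw [mem_outerSide] at hx hy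
  by_contra hyN
  exact hx.2 ⟨hx.1, y, not_not.1 fun h => hy ⟨h, hyN⟩, hxy.symm⟩

theorem subset_outerSide_outerSide (A : Set V) : A ⊆ X.outerSide (X.outerSide A) := by
  intro x hx
  rw [mem_outerSide]
  exact ⟨fun h => (mem_outerSide.1 h).1 hx, fun h => (outerBoundary_outerSide_subset A h).1 hx⟩

/-- `A` has finite boundary and separates the filter `l₁` from the filter `l₂`. -/
structure IsCut (X : SimpleGraph V) (l₁ l₂ : Filter V) (A : Set V) : Prop where
  finite : (X.outerBoundary A).Finite
  mem : A ∈ l₁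
  compl_mem : Aᶜ ∈ l₂

/-- A cut whose boundary has the least possible number of vertices. -/
structure IsMinCut (X : SimpleGraph V) (l₁ l₂ : Filter V) (A : Set V) : Prop extends
    X.IsCut l₁ l₂ A where
  le : ∀ B, X.IsCut l₁ l₂ B → (X.outerBoundary A).ncard ≤ (X.outerBoundary B).ncard

variable {l₁ l₂ : Filter V} {A B : Set V}

theorem IsCut.exists_isMinCut (hA : X.IsCut l₁ l₂ A) : ∃ B, X.IsMinCut l₁ l₂ B := by
  classical
  have h : ∃ n, ∃ B, X.IsCut l₁ l₂ B ∧ (X.outerBoundary B).ncard = n := ⟨_, A, hA, rfl⟩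
  obtain ⟨B, hB, hn⟩ := Nat.find_spec h
  exact ⟨B, hB, fun C hC => hn ▸ Nat.find_min' h ⟨C, hC, rfl⟩⟩

theorem IsCut.outerSide (h₁ : l₂ ≤ Filter.cofinite) (hA : X.IsCut l₁ l₂ A) :
    X.IsCut l₂ l₁ (X.outerSide A) where
  finite := hA.finite.subset (outerBoundary_outerSide_subset A)
  mem := by
    rw [SimpleGraph.outerSide, Set.compl_union]
    exact Filter.inter_mem hA.compl_mem (h₁ hA.finite.compl_mem_cofinite)
  compl_mem := by
    rw [SimpleGraph.outerSide, compl_compl]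
    exact Filter.mem_of_superset hA.mem Set.subset_union_left

theorem IsMinCut.outerSide (h₁ : l₁ ≤ Filter.cofinite) (h₂ : l₂ ≤ Filter.cofinite)
    (hA : X.IsMinCut l₁ l₂ A) : X.IsMinCut l₂ l₁ (X.outerSide A) where
  toIsCut := hA.toIsCut.outerSide h₂
  le C hC :=
    (Set.ncard_le_ncard (outerBoundary_outerSide_subset A) hA.finite).trans <|
      (hA.le _ (hC.outerSide h₁)).trans <|
        Set.ncard_le_ncard (outerBoundary_outerSide_subset C) hC.finite

theorem IsMinCut.outerBoundary_outerSide (h₁ : l₁ ≤ Filter.cofinite) (h₂ : l₂ ≤ Filter.cofinite)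
    (hA : X.IsMinCut l₁ l₂ A) : X.outerBoundary (X.outerSide A) = X.outerBoundary A := by
  refine Set.eq_of_subset_of_ncard_le (outerBoundary_outerSide_subset A) ?_ hA.finite
  have hC := hA.toIsCut.outerSide h₂
  exact (hA.le _ (hC.outerSide h₁)).trans <|
    Set.ncard_le_ncard (outerBoundary_outerSide_subset _) hC.finite

theorem outerBoundary_inter_union_subset (A B : Set V) :
    X.outerBoundary (A ∩ B) ∪ X.outerBoundary (A ∪ B) ⊆
      X.outerBoundary A ∪ X.outerBoundary B := by
  rintro y (⟨hy, x, hx, hxy⟩ | ⟨hy, x, hx, hxy⟩)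
  · by_cases hyA : y ∈ A
    · exact .inr ⟨fun h => hy ⟨hyA, h⟩, x, hx.2, hxy⟩
    · exact .inl ⟨hyA, x, hx.1, hxy⟩
  · rcases hx with hx | hx
    · exact .inl ⟨fun h => hy (.inl h), x, hx, hxy⟩
    · exact .inr ⟨fun h => hy (.inr h), x, hx, hxy⟩

theorem outerBoundary_inter_inter_subset (A B : Set V) :
    X.outerBoundary (A ∩ B) ∩ X.outerBoundary (A ∪ B) ⊆
      X.outerBoundary A ∩ X.outerBoundary B := by
  rintro y ⟨⟨-, x, hx, hxy⟩, hy, -⟩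
  exact ⟨⟨fun h => hy (.inl h), x, hx.1, hxy⟩, ⟨fun h => hy (.inr h), x, hx.2, hxy⟩⟩

theorem IsCut.inter (hA : X.IsCut l₁ l₂ A) (hB : X.IsCut l₁ l₂ B) : X.IsCut l₁ l₂ (A ∩ B) where
  finite := (hA.finite.union hB.finite).subset
    (Set.subset_union_left.trans (outerBoundary_inter_union_subset A B))
  mem := Filter.inter_mem hA.mem hB.mem
  compl_mem := Filter.mem_of_superset hA.compl_mem
    (Set.compl_subset_compl.2 Set.inter_subset_left)

theorem IsCut.union (hA : X.IsCut l₁ l₂ A) (hB : X.IsCut l₁ l₂ B) : X.IsCut l₁ l₂ (A ∪ B) where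
  finite := (hA.finite.union hB.finite).subset
    (Set.subset_union_right.trans (outerBoundary_inter_union_subset A B))
  mem := Filter.mem_of_superset hA.mem Set.subset_union_left
  compl_mem := by
    rw [Set.compl_union]
    exact Filter.inter_mem hA.compl_mem hB.compl_mem

theorem IsCut.ncard_inter_add_ncard_union (hA : X.IsCut l₁ l₂ A) (hB : X.IsCut l₁ l₂ B) :
    (X.outerBoundary (A ∩ B)).ncard + (X.outerBoundary (A ∪ B)).ncard ≤
      (X.outerBoundary (A ∩ B) ∪ X.outerBoundary (A ∪ B)).ncard +
        (X.outerBoundary A ∩ X.outerBoundary B).ncard := by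
  rw [← Set.ncard_union_add_ncard_inter _ _ (hA.inter hB).finite (hA.union hB).finite]
  exact Nat.add_le_add_left (Set.ncard_le_ncard (outerBoundary_inter_inter_subset A B)
    (hA.finite.subset Set.inter_subset_left)) _

/-- Submodularity bounds the sum of the two boundary sizes by twice the minimum, and both are at
least the minimum, so every inequality is an equality. -/
theorem IsMinCut.inter_union (hA : X.IsMinCut l₁ l₂ A) (hB : X.IsMinCut l₁ l₂ B) :
    (X.outerBoundary (A ∩ B)).ncard = (X.outerBoundary A).ncard ∧
      (X.outerBoundary (A ∪ B)).ncard = (X.outerBoundary A).ncard ∧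
      X.outerBoundary (A ∩ B) ∪ X.outerBoundary (A ∪ B) =
        X.outerBoundary A ∪ X.outerBoundary B := by
  have h₁ := hA.toIsCut.ncard_inter_add_ncard_union hB.toIsCut
  have h₂ := Set.ncard_union_add_ncard_inter _ _ hA.finite hB.finite
  have h₃ := Set.ncard_le_ncard (outerBoundary_inter_union_subset (X := X) A B)
    (hA.finite.union hB.finite)
  have h₄ := hA.le _ (hA.toIsCut.inter hB.toIsCut)
  have h₅ := hA.le _ (hA.toIsCut.union hB.toIsCut)
  have h₆ := hA.le _ hB.toIsCut
  have h₇ := hB.le _ hA.toIsCut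
  refine ⟨by omega, by omega, ?_⟩
  exact Set.eq_of_subset_of_ncard_le (outerBoundary_inter_union_subset A B) (by omega)
    (hA.finite.union hB.finite)

theorem IsMinCut.inter (hA : X.IsMinCut l₁ l₂ A) (hB : X.IsMinCut l₁ l₂ B) :
    X.IsMinCut l₁ l₂ (A ∩ B) where
  toIsCut := hA.toIsCut.inter hB.toIsCut
  le C hC := (hA.inter_union hB).1 ▸ hA.le C hC

theorem IsMinCut.union (hA : X.IsMinCut l₁ l₂ A) (hB : X.IsMinCut l₁ l₂ B) :
    X.IsMinCut l₁ l₂ (A ∪ B) where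
  toIsCut := hA.toIsCut.union hB.toIsCut
  le C hC := (hA.inter_union hB).2.1 ▸ hA.le C hC

theorem IsMinCut.mem_outerBoundary_inter (hA : X.IsMinCut l₁ l₂ A) (hB : X.IsMinCut l₁ l₂ B)
    {x : V} (hxA : x ∈ A) (hxB : x ∈ X.outerBoundary B) : x ∈ X.outerBoundary (A ∩ B) := by
  have h : x ∈ X.outerBoundary (A ∩ B) ∪ X.outerBoundary (A ∪ B) :=
    (hA.inter_union hB).2.2 ▸ .inr hxB
  exact h.resolve_right fun h => h.1 (.inl hxA)

/-! ### Minimum cuts differ by finite sets -/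

/-- Every walk from `S` to `T` meets `F`. -/
def Separates (X : SimpleGraph V) (S T F : Set V) : Prop :=
  ∀ ⦃x y : V⦄ (w : X.Walk x y), x ∈ S → y ∈ T → ∃ z ∈ w.support, z ∈ F

/-- The vertices that can be reached from `S` along a walk avoiding `F`. -/
def reachableAvoiding (X : SimpleGraph V) (S F : Set V) : Set V :=
  {y | ∃ x ∈ S, ∃ w : X.Walk x y, ∀ z ∈ w.support, z ∉ F}

theorem outerBoundary_reachableAvoiding_subset (S F : Set V) :
    X.outerBoundary (X.reachableAvoiding S F) ⊆ F := by
  rintro y ⟨hy, x, ⟨s, hs, w, hw⟩, hxy⟩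
  by_contra hyF
  refine hy ⟨s, hs, w.concat hxy, fun z hz => ?_⟩
  rw [Walk.support_concat, List.mem_append, List.mem_singleton] at hz
  rcases hz with hz | rfl
  · exact hw z hz
  · exact hyF

theorem diff_subset_reachableAvoiding (S F : Set V) : S \ F ⊆ X.reachableAvoiding S F :=
  fun x hx => ⟨x, hx.1, .nil, by simpa using hx.2⟩

theorem Separates.isCut {S T F : Set V} (h : X.Separates S T F) (hF : F.Finite)
    (h₁ : l₁ ≤ Filter.cofinite) (hS : S ∈ l₁) (hT : T ∈ l₂) :
    X.IsCut l₁ l₂ (X.reachableAvoiding S F) where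
  finite := hF.subset (outerBoundary_reachableAvoiding_subset S F)
  mem := Filter.mem_of_superset (Filter.inter_mem hS (h₁ hF.compl_mem_cofinite))
    (diff_subset_reachableAvoiding S F)
  compl_mem := Filter.mem_of_superset hT fun y hy ⟨x, hx, w, hw⟩ => by
    obtain ⟨z, hz, hzF⟩ := h w hx hy
    exact hw z hz hzF

/-- Finite branching: a set `F₀` with fewer than `k` vertices misses some walk from `S` to `T`, and
every separator containing `F₀` must contain one of the finitely many vertices of that walk. The
induction is on the number `j` of vertices still to be chosen. -/
theorem finite_setOf_separates {S T : Set V} {k : ℕ}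
    (h : ∀ F : Finset V, X.Separates S T F → k ≤ F.card) :
    {F : Finset V | X.Separates S T F ∧ F.card = k}.Finite := by
  classical
  suffices H : ∀ (j : ℕ) (F₀ : Finset V), F₀.card + j = k →
      {F : Finset V | X.Separates S T F ∧ F.card = k ∧ F₀ ⊆ F}.Finite by
    simpa using H k ∅ (by simp)
  intro j
  induction j with
  | zero =>
    intro F₀ h₀
    refine (Set.finite_singleton F₀).subset fun F hF => ?_
    exact (Finset.eq_of_subset_of_card_le hF.2.2 (by have := hF.2.1; omega)).symm
  | succ j ih =>
    intro F₀ h₀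
    have hns : ¬ X.Separates S T F₀ := fun hs => by have := h F₀ hs; omega
    simp only [Separates, not_forall, not_exists, not_and] at hns
    obtain ⟨x, y, w, hx, hy, hw⟩ := hns
    have hfin : (⋃ p ∈ w.support.toFinset \ F₀,
        {F : Finset V | X.Separates S T F ∧ F.card = k ∧ insert p F₀ ⊆ F}).Finite := by
      refine Set.Finite.biUnion (Finset.finite_toSet _) fun p hp => ih _ ?_
      have : p ∉ F₀ := (Finset.mem_sdiff.1 hp).2
      rw [Finset.card_insert_of_notMem this]
      omega
    refine hfin.subset fun F hF => ?_
    obtain ⟨p, hp, hpF⟩ := hF.1 w hx hy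
    have hp₀ : p ∉ F₀ := hw p hp
    exact Set.mem_biUnion (x := p) (by simp [hp, hp₀])
      ⟨hF.1, hF.2.1, Finset.insert_subset hpF hF.2.2⟩

theorem separates_outerBoundary {S T C : Set V} (hS : S ⊆ C) (hT : T ⊆ Cᶜ) :
    X.Separates S T (X.outerBoundary C) := by
  intro x y w hx hy
  by_contra! hw
  exact hT hy (w.mem_of_disjoint_outerBoundary (hS hx) hw)

/-- Each vertex of `A \ B` lies on the boundary of a minimum cut between `B` and `A`. Such a
boundary is a least separator of `B` from `Aᶜ`, and there are finitely many of these. -/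
theorem IsMinCut.finite_diff_of_subset (h₁ : l₁ ≤ Filter.cofinite)
    (hcov : ∀ x, ∃ B, X.IsMinCut l₁ l₂ B ∧ x ∈ X.outerBoundary B)
    (hA : X.IsMinCut l₁ l₂ A) (hB : X.IsMinCut l₁ l₂ B) (hBA : B ⊆ A) : (A \ B).Finite := by
  have hfin : {F : Finset V | X.Separates B Aᶜ F ∧ F.card = (X.outerBoundary A).ncard}.Finite := by
    refine finite_setOf_separates fun F hF => ?_
    refine (hA.le _ (hF.isCut F.finite_toSet h₁ hB.mem hA.compl_mem)).trans ?_
    rw [← Set.ncard_coe_finset F]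
    exact Set.ncard_le_ncard (outerBoundary_reachableAvoiding_subset _ _) F.finite_toSet
  refine (hfin.biUnion fun F _ => F.finite_toSet).subset fun x hx => ?_
  obtain ⟨C, hC, hxC⟩ := hcov x
  have hAC := hA.inter hC
  -- Intersecting with `A` and joining `B` squeezes `C` between `B` and `A`, while `x` stays on the
  -- boundary because it is in `A` and not in `B`.
  have hD := hAC.union hB
  have hxAC := hA.mem_outerBoundary_inter hC hx.1 hxC
  have hxD : x ∈ X.outerBoundary (A ∩ C ∪ B) := by
    obtain ⟨hx', y, hy, hyx⟩ := hxAC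
    exact ⟨fun h => h.elim hx' hx.2, y, .inl hy, hyx⟩
  refine Set.mem_biUnion (x := hD.finite.toFinset) ⟨?_, ?_⟩ (by simpa using hxD)
  · rw [Set.Finite.coe_toFinset]
    exact separates_outerBoundary Set.subset_union_right
      (Set.compl_subset_compl.2 (Set.union_subset Set.inter_subset_left hBA))
  · rw [← Set.ncard_eq_toFinset_card _ hD.finite]
    exact le_antisymm (hD.le _ hA.toIsCut) (hA.le _ hD.toIsCut)

theorem IsMinCut.finite_diff (h₁ : l₁ ≤ Filter.cofinite)
    (hcov : ∀ x, ∃ B, X.IsMinCut l₁ l₂ B ∧ x ∈ X.outerBoundary B)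
    (hA : X.IsMinCut l₁ l₂ A) (hB : X.IsMinCut l₁ l₂ B) : (A \ B).Finite := by
  rw [← Set.sdiff_self_inter]
  exact hA.finite_diff_of_subset h₁ hcov (hA.inter hB) Set.inter_subset_left

/-- The neighbours of `v` avoid `B` and lie in `A` or on its boundary, hence in the union of two
finite sets. -/
theorem IsMinCut.finite_neighborSet (h₁ : l₁ ≤ Filter.cofinite)
    (hcov : ∀ x, ∃ B, X.IsMinCut l₁ l₂ B ∧ x ∈ X.outerBoundary B)
    (hA : X.IsMinCut l₁ l₂ A) (hB : X.IsMinCut l₁ l₂ B) {v : V} (hvA : v ∈ A)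
    (hvB : v ∈ X.outerSide B) : (X.neighborSet v).Finite := by
  refine ((hA.finite_diff h₁ hcov hB).union hA.finite).subset fun w hw => ?_
  have hwB : w ∉ B := fun h => hvB (or_iff_not_imp_left.2 fun hv => ⟨hv, w, h, hw.symm⟩)
  by_cases hwA : w ∈ A
  · exact .inl ⟨hwA, hwB⟩
  · exact .inr ⟨hwA, v, hvA, hw⟩

/-! ### Nested cuts -/

/-- No edge leaves `A \ B`: it would end in `B`, putting a vertex of `A` on the boundary of `B`, or
outside both sets, putting a boundary vertex of `A` outside `B`. -/
theorem subset_of_outerBoundary (hX : X.Connected) (hN : (X.outerBoundary A).Nonempty)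
    (h₁ : X.outerBoundary A ⊆ B) (h₂ : Disjoint (X.outerBoundary B) A) : A ⊆ B := by
  have h : X.outerBoundary (A \ B) = ∅ := by
    refine Set.eq_empty_of_forall_notMem ?_
    rintro y ⟨hy, x, hx, hxy⟩
    by_cases hyB : y ∈ B
    · exact Set.disjoint_left.1 h₂ ⟨hx.2, y, hyB, hxy.symm⟩ hx.1
    · exact hyB (h₁ ⟨fun h => hy ⟨h, hyB⟩, x, hx.1, hxy⟩)
  rcases hX.eq_empty_or_univ h with h | h
  · exact Set.sdiff_eq_empty.1 h
  · obtain ⟨y, hy⟩ := hN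
    exact absurd (h ▸ Set.mem_univ y : y ∈ A \ B).1 hy.1

theorem IsCut.outerBoundary_nonempty [l₁.NeBot] [l₂.NeBot] (hX : X.Connected)
    (hA : X.IsCut l₁ l₂ A) : (X.outerBoundary A).Nonempty := by
  rw [Set.nonempty_iff_ne_empty]
  intro h
  rcases hX.eq_empty_or_univ h with rfl | rfl
  · exact Filter.empty_notMem l₁ hA.mem
  · exact Filter.empty_notMem l₂ (by simpa using hA.compl_mem)

/-- The mixed cases give nesting. If both boundaries lie inside the other cut, the union has empty
boundary; if both lie outside, the intersection has. Neither can happen to a cut of a connected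
graph. -/
theorem IsCut.ssubset_or_ssubset [l₁.NeBot] [l₂.NeBot] (hX : X.Connected)
    (hA : X.IsCut l₁ l₂ A) (hB : X.IsCut l₁ l₂ B)
    (hAB : Disjoint (X.outerBoundary A) (X.outerBoundary B))
    (h₁ : X.outerBoundary A ⊆ B ∨ Disjoint (X.outerBoundary A) B)
    (h₂ : X.outerBoundary B ⊆ A ∨ Disjoint (X.outerBoundary B) A) : A ⊂ B ∨ B ⊂ A := by
  have hNA := hA.outerBoundary_nonempty hX
  have hNB := hB.outerBoundary_nonempty hX
  rcases h₁ with h₁ | h₁ <;> rcases h₂ with h₂ | h₂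
  · obtain ⟨y, hy⟩ := (hA.union hB).outerBoundary_nonempty hX
    rcases outerBoundary_inter_union_subset A B (.inr hy) with h | h
    · exact absurd (.inr (h₁ h)) hy.1
    · exact absurd (.inl (h₂ h)) hy.1
  · have ⟨y, hy⟩ := hNA
    exact .inl ⟨subset_of_outerBoundary hX hNA h₁ h₂, fun h => hy.1 (h (h₁ hy))⟩
  · have ⟨y, hy⟩ := hNB
    exact .inr ⟨subset_of_outerBoundary hX hNB h₂ h₁, fun h => hy.1 (h (h₂ hy))⟩
  · obtain ⟨y, hy, x, hx, hxy⟩ := (hA.inter hB).outerBoundary_nonempty hX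
    rcases outerBoundary_inter_union_subset A B (.inl ⟨hy, x, hx, hxy⟩) with h | h
    · exact absurd ⟨fun hyB => Set.disjoint_left.1 h₁ h hyB, x, hx.2, hxy⟩
        (Set.disjoint_left.1 hAB h)
    · exact absurd h
        (Set.disjoint_left.1 hAB ⟨fun hyA => Set.disjoint_left.1 h₂ h hyA, x, hx.1, hxy⟩)

/-! ### Balls -/

theorem Connected.finite_setOf_dist_le (hX : X.Connected)
    (hfin : ∀ v, (X.neighborSet v).Finite) (v : V) (n : ℕ) : {x | X.dist v x ≤ n}.Finite := by
  induction n with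
  | zero =>
    refine (Set.finite_singleton v).subset fun x hx => ?_
    have hx : X.dist v x ≤ 0 := hx
    exact (hX.dist_eq_zero_iff.1 (Nat.le_zero.1 hx)).symm
  | succ n ih =>
    refine (ih.union (ih.biUnion fun y _ => hfin y)).subset fun x hx => ?_
    obtain ⟨w, hw⟩ := hX.exists_walk_length_eq_dist x v
    cases w with
    | nil => exact .inl (by simp)
    | cons hadj p =>
      rename_i y
      refine .inr (Set.mem_biUnion (x := y) ?_ hadj.symm)
      have h := dist_le p
      have hx : X.dist v x ≤ n + 1 := hx
      rw [dist_comm] at hx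
      rw [Walk.length_cons] at hw
      change X.dist v y ≤ n
      rw [dist_comm]
      omega

theorem Connected.ball_subset_or_disjoint (hX : X.Connected) {v : V} {n : ℕ}
    (h : ∀ y ∈ X.outerBoundary B, n < X.dist v y) :
    {x | X.dist v x ≤ n} ⊆ B ∨ Disjoint {x | X.dist v x ≤ n} B := by
  have key : ∀ x, X.dist v x ≤ n → ∃ w : X.Walk v x, ∀ z ∈ w.support, z ∉ X.outerBoundary B := by
    intro x hx
    obtain ⟨w, hw⟩ := hX.exists_walk_length_eq_dist v x
    refine ⟨w, fun z hz hzB => ?_⟩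
    classical
    have h₁ := dist_le (w.takeUntil z hz)
    have h₂ := w.length_takeUntil_le_length hz
    have h₃ := h z hzB
    omega
  by_cases hv : v ∈ B
  · refine .inl fun x hx => ?_
    obtain ⟨w, hw⟩ := key x hx
    exact w.mem_of_disjoint_outerBoundary hv hw
  · refine .inr (Set.disjoint_left.2 fun x hx hxB => hv ?_)
    obtain ⟨w, hw⟩ := key x hx
    exact w.reverse.mem_of_disjoint_outerBoundary hxB fun z hz => hw z (by simpa using hz)

theorem IsCut.ssubset_or_ssubset_of_dist [l₁.NeBot] [l₂.NeBot] (hX : X.Connected)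
    (hA : X.IsCut l₁ l₂ A) (hB : X.IsCut l₁ l₂ B) {v w : V} {n : ℕ}
    (h₁ : ∀ y ∈ X.outerBoundary A, X.dist v y ≤ n) (h₂ : ∀ y ∈ X.outerBoundary B, X.dist w y ≤ n)
    (h : 2 * n < X.dist v w) : A ⊂ B ∨ B ⊂ A := by
  have h₁' : ∀ y ∈ X.outerBoundary A, n < X.dist w y := fun y hy => by
    have := hX.dist_triangle (u := v) (v := y) (w := w)
    have := h₁ y hy
    have := X.dist_comm (u := y) (v := w)
    omega
  have h₂' : ∀ y ∈ X.outerBoundary B, n < X.dist v y := fun y hy => by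
    have := hX.dist_triangle (u := v) (v := y) (w := w)
    have := h₂ y hy
    have := X.dist_comm (u := y) (v := w)
    omega
  refine hA.ssubset_or_ssubset hX hB (Set.disjoint_left.2 fun y hy hy' => ?_) ?_ ?_
  · have := h₁ y hy
    have := h₂' y hy'
    omega
  · exact (hX.ball_subset_or_disjoint h₂').imp (fun h x hx => h (h₁ x hx))
      fun h => h.mono_left h₁
  · exact (hX.ball_subset_or_disjoint h₁').imp (fun h x hx => h (h₂ x hx))
      fun h => h.mono_left h₂

end SimpleGraph

/-! ### Commensurate sets and their relative size. -/

namespace Set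

variable {V : Type*} {A B C S : Set V}

/-- Two sets are commensurate if they differ by finite sets. -/
def Commensurate (A B : Set V) : Prop := (A \ B).Finite ∧ (B \ A).Finite

theorem Commensurate.symm (h : Commensurate A B) : Commensurate B A := ⟨h.2, h.1⟩

theorem Commensurate.trans (h₁ : Commensurate A B) (h₂ : Commensurate B C) : Commensurate A C :=
  ⟨(h₁.1.union h₂.1).subset fun x hx => by
      by_cases hB : x ∈ B
      exacts [.inr ⟨hB, hx.2⟩, .inl ⟨hx.1, hB⟩],
    (h₁.2.union h₂.2).subset fun x hx => by
      by_cases hB : x ∈ B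
      exacts [.inl ⟨hB, hx.2⟩, .inr ⟨hx.1, hB⟩]⟩

/-- The relative size of two commensurate sets. -/
noncomputable def relSize (A B : Set V) : ℤ := (A \ B).ncard - (B \ A).ncard

theorem relSize_compl (A B : Set V) : relSize Aᶜ Bᶜ = - relSize A B := by
  rw [relSize, compl_sdiff_compl, compl_sdiff_compl, relSize]
  ring

/-- Inside one finite window the relative size is a difference of cardinalities, so additivity
becomes telescoping. -/
theorem relSize_eq (hS : S.Finite) (h₁ : A \ B ⊆ S) (h₂ : B \ A ⊆ S) :
    relSize A B = (A ∩ S).ncard - (B ∩ S).ncard := by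
  have key : ∀ {A B : Set V}, A \ B ⊆ S →
      (A ∩ S).ncard = (A ∩ B ∩ S).ncard + (A \ B).ncard := by
    intro A B h
    rw [← ncard_union_eq _ (hS.subset inter_subset_right) (hS.subset h)]
    · congr 1
      ext x
      have := @h x
      simp only [mem_inter_iff, mem_union, mem_sdiff] at this ⊢
      tauto
    · exact disjoint_left.2 fun x hx hx' => hx'.2 hx.1.2
  have h₃ := key h₁
  have h₄ := key h₂
  rw [inter_comm B A] at h₄
  rw [relSize]
  omega

theorem relSize_add (h₁ : Commensurate A B) (h₂ : Commensurate B C) :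
    relSize A B + relSize B C = relSize A C := by
  have h₃ := h₁.trans h₂
  have hS : (((A \ B ∪ B \ A) ∪ (B \ C ∪ C \ B)) ∪ (A \ C ∪ C \ A)).Finite :=
    ((h₁.1.union h₁.2).union (h₂.1.union h₂.2)).union (h₃.1.union h₃.2)
  rw [relSize_eq hS, relSize_eq hS, relSize_eq hS]
  · ring
  all_goals
    intro x hx
    simp only [mem_union]
    tauto

theorem relSize_swap (A B : Set V) : relSize A B = - relSize B A := by
  rw [relSize, relSize]
  ring

theorem relSize_ne_zero (h : Commensurate A B) (hs : A ⊂ B ∨ B ⊂ A) : relSize A B ≠ 0 := by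
  have key : ∀ {A B : Set V}, Commensurate A B → A ⊂ B → relSize A B ≠ 0 := by
    intro A B h hs
    have h₁ : 0 < (B \ A).ncard := (ncard_pos h.2).2 (nonempty_of_ssubset hs)
    rw [relSize, sdiff_eq_empty.2 hs.subset, ncard_empty]
    omega
  rcases hs with hs | hs
  · exact key h hs
  · rw [relSize_swap, neg_ne_zero]
    exact key h.symm hs

open Pointwise

variable {G : Type*} [Group G] [MulAction G V]

theorem Commensurate.smul (g : G) (h : Commensurate A B) : Commensurate (g • A) (g • B) := by
  rw [Commensurate, ← smul_set_sdiff, ← smul_set_sdiff]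
  exact ⟨h.1.smul_set, h.2.smul_set⟩

theorem relSize_smul (g : G) (A B : Set V) : relSize (g • A) (g • B) = relSize A B := by
  rw [relSize, ← smul_set_sdiff, ← smul_set_sdiff]
  simp [relSize]

/-- The translation length of `g` depends only on the commensurability class. -/
theorem relSize_smul_congr {g : G} (h : Commensurate A B) (hA : Commensurate A (g • A)) :
    relSize A (g • A) = relSize B (g • B) := by
  have hB : Commensurate B (g • B) := h.symm.trans (hA.trans (h.smul g))
  rw [← relSize_add h (hB.trans (h.smul g).symm), ← relSize_add hB (h.smul g).symm,
    relSize_smul, relSize_swap A B]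
  ring

end Set

namespace Digraph

open Pointwise Filter

variable {V : Type*} {Γ : Digraph V}

/-! ### Ends and vertex sets with finite boundary -/

/-- The filter of vertex sets that contain a tail of a ray. -/
def Ray.filter (R : Γ.Ray) : Filter V := map R.vert atTop

instance (R : Γ.Ray) : R.filter.NeBot := inferInstanceAs (map R.vert atTop).NeBot

theorem Ray.filter_le_cofinite (R : Γ.Ray) : R.filter ≤ cofinite := by
  rw [filter, ← Nat.cofinite_eq_atTop]
  exact R.inj.tendsto_cofinite

theorem Ray.mem_filter {R : Γ.Ray} {A : Set V} : A ∈ R.filter ↔ ∃ n, ∀ m ≥ n, R.vert m ∈ A :=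
  mem_map.trans mem_atTop_sets

/-- Every exit from `A` lands on its finite boundary, which the ray eventually avoids. On sets with
finite boundary the tail filter thus behaves like an ultrafilter. -/
theorem Ray.mem_filter_of_frequently {R : Γ.Ray} {A : Set V}
    (hA : (Γ.underlying.outerBoundary A).Finite) (h : ∀ n, ∃ m ≥ n, R.vert m ∈ A) :
    A ∈ R.filter := by
  obtain ⟨n, hn⟩ := Ray.mem_filter.1 (R.filter_le_cofinite hA.compl_mem_cofinite)
  obtain ⟨m, hm, hmA⟩ := h n
  refine Ray.mem_filter.2 ⟨m, fun j hj => ?_⟩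
  induction j, hj using Nat.le_induction with
  | base => exact hmA
  | succ j hj ih =>
    by_contra hjA
    exact hn (j + 1) (by omega) ⟨hjA, _, ih, R.adj j⟩

theorem Ray.mem_filter_or_compl_mem_filter (R : Γ.Ray) {A : Set V}
    (hA : (Γ.underlying.outerBoundary A).Finite) : A ∈ R.filter ∨ Aᶜ ∈ R.filter := by
  refine or_iff_not_imp_left.2 fun h => ?_
  have h' := mt (Ray.mem_filter_of_frequently hA) h
  push Not at h'
  exact Ray.mem_filter.2 h'

theorem RayEquiv.mem_filter {R S : Γ.Ray} (h : Γ.RayEquiv R S) {A : Set V}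
    (hN : (Γ.underlying.outerBoundary A).Finite) (hA : A ∈ R.filter) : A ∈ S.filter := by
  classical
  obtain ⟨n, hn⟩ := Ray.mem_filter.1 hA
  refine Ray.mem_filter_of_frequently hN fun m => ?_
  obtain ⟨i, j, p, hp⟩ := (Γ.rayEquiv_iff R S).1 h
    (hN.toFinset ∪ ((Finset.range n).image R.vert ∪ (Finset.range m).image S.vert))
  simp only [Finset.mem_union, Set.Finite.mem_toFinset, Finset.mem_image, Finset.mem_range,
    not_or, not_exists, not_and] at hp
  have hi : n ≤ i := by
    by_contra hi
    exact (hp _ p.start_mem_support).2.1 i (by omega) rfl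
  have hj : m ≤ j := by
    by_contra hj
    exact (hp _ p.end_mem_support).2.2 j (by omega) rfl
  exact ⟨j, hj, p.mem_of_disjoint_outerBoundary (hn i hi) fun z hz => (hp z hz).1⟩

theorem RayEquiv.compl_mem_filter {R S : Γ.Ray} (h : Γ.RayEquiv R S) {A : Set V}
    (hN : (Γ.underlying.outerBoundary A).Finite) (hA : Aᶜ ∈ R.filter) : Aᶜ ∈ S.filter := by
  refine (S.mem_filter_or_compl_mem_filter hN).resolve_left fun hS => ?_
  exact empty_notMem R.filter (by simpa using inter_mem ((Γ.rayEquiv_symm h).mem_filter hN hS) hA)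

theorem exists_isCut {R S : Γ.Ray} (h : ¬ Γ.RayEquiv R S) :
    ∃ A, Γ.underlying.IsCut R.filter S.filter A := by
  rw [rayEquiv_iff] at h
  push Not at h
  obtain ⟨F, hF⟩ := h
  refine ⟨_, SimpleGraph.Separates.isCut (S := Set.range R.vert) (T := Set.range S.vert) ?_
    F.finite_toSet R.filter_le_cofinite (Ray.mem_filter.2 ⟨0, fun m _ => ⟨m, rfl⟩⟩)
    (Ray.mem_filter.2 ⟨0, fun m _ => ⟨m, rfl⟩⟩)⟩
  rintro _ _ w ⟨i, rfl⟩ ⟨j, rfl⟩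
  exact hF i j w

/-! ### Automorphisms -/

theorem underlying_adj_iff {x y : V} :
    Γ.underlying.Adj x y ↔ x ≠ y ∧ (Γ.Adj x y ∨ Γ.Adj y x) := by
  rw [underlying, toSimpleGraphInclusive, SimpleGraph.fromRel_adj]

theorem Aut.adj_smul_iff (g : Γ.Aut) {x y : V} : Γ.Adj (g • x) (g • y) ↔ Γ.Adj x y :=
  g.map_rel_iff

theorem Aut.underlying_adj_smul_iff (g : Γ.Aut) {x y : V} :
    Γ.underlying.Adj (g • x) (g • y) ↔ Γ.underlying.Adj x y := by
  simp only [underlying_adj_iff, g.adj_smul_iff, ne_eq, smul_left_cancel_iff]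

theorem Aut.outerBoundary_smul (g : Γ.Aut) (A : Set V) :
    Γ.underlying.outerBoundary (g • A) = g • Γ.underlying.outerBoundary A := by
  ext y
  rw [Set.mem_smul_set_iff_inv_smul_mem]
  refine and_congr (not_congr Set.mem_smul_set_iff_inv_smul_mem) ⟨?_, ?_⟩
  · rintro ⟨_, ⟨x, hx, rfl⟩, hxy⟩
    exact ⟨x, hx, by rwa [← g.underlying_adj_smul_iff, smul_inv_smul]⟩
  · rintro ⟨x, hx, hxy⟩
    exact ⟨g • x, Set.smul_mem_smul_set hx,
      by rwa [← g.underlying_adj_smul_iff, smul_inv_smul] at hxy⟩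

theorem Aut.outerSide_smul (g : Γ.Aut) (A : Set V) :
    Γ.underlying.outerSide (g • A) = g • Γ.underlying.outerSide A := by
  rw [SimpleGraph.outerSide, SimpleGraph.outerSide, outerBoundary_smul, Set.smul_set_compl,
    Set.smul_set_union]

theorem Aut.dist_smul (hΓ : Γ.IsConnected) (g : Γ.Aut) (x y : V) :
    Γ.underlying.dist (g • x) (g • y) = Γ.underlying.dist x y := by
  have key : ∀ (g : Γ.Aut) (x y : V),
      Γ.underlying.dist (g • x) (g • y) ≤ Γ.underlying.dist x y := by
    intro g x y
    obtain ⟨w, hw⟩ := SimpleGraph.Connected.exists_walk_length_eq_dist hΓ x y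
    rw [← hw, ← w.length_map g.underlyingHom]
    exact SimpleGraph.dist_le (w.map g.underlyingHom)
  refine (key g x y).antisymm ?_
  simpa using key g⁻¹ (g • x) (g • y)

theorem Aut.smul_mem_filter_mapRay (g : Γ.Aut) {R : Γ.Ray} {A : Set V} (hA : A ∈ R.filter) :
    g • A ∈ (g.mapRay R).filter := by
  obtain ⟨n, hn⟩ := Ray.mem_filter.1 hA
  exact Ray.mem_filter.2 ⟨n, fun m hm => ⟨_, hn m hm, rfl⟩⟩

theorem Aut.isCut_smul (g : Γ.Aut) {R₁ R₂ S₁ S₂ : Γ.Ray} (h₁ : Γ.RayEquiv (g.mapRay R₁) S₁)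
    (h₂ : Γ.RayEquiv (g.mapRay R₂) S₂) {A : Set V}
    (hA : Γ.underlying.IsCut R₁.filter R₂.filter A) :
    Γ.underlying.IsCut S₁.filter S₂.filter (g • A) := by
  have hN : (Γ.underlying.outerBoundary (g • A)).Finite := by
    rw [g.outerBoundary_smul]
    exact hA.finite.smul_set
  refine ⟨hN, h₁.mem_filter hN (g.smul_mem_filter_mapRay hA.mem), h₂.compl_mem_filter hN ?_⟩
  rw [← Set.smul_set_compl]
  exact g.smul_mem_filter_mapRay hA.compl_mem

theorem Aut.rayEquiv_inv_mapRay (g : Γ.Aut) {R S : Γ.Ray} (h : Γ.RayEquiv (g.mapRay R) S) :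
    Γ.RayEquiv (g⁻¹.mapRay S) R := by
  have := g⁻¹.mapRay_equiv (Γ.rayEquiv_symm h)
  have e : g⁻¹.mapRay (g.mapRay R) = R := by
    cases R
    simp only [mapRay, Ray.mk.injEq]
    funext n
    exact inv_smul_smul g _
  rwa [e] at this

theorem Aut.isMinCut_smul (g : Γ.Aut) {R₁ R₂ S₁ S₂ : Γ.Ray} (h₁ : Γ.RayEquiv (g.mapRay R₁) S₁)
    (h₂ : Γ.RayEquiv (g.mapRay R₂) S₂) {A : Set V}
    (hA : Γ.underlying.IsMinCut R₁.filter R₂.filter A) :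
    Γ.underlying.IsMinCut S₁.filter S₂.filter (g • A) where
  toIsCut := g.isCut_smul h₁ h₂ hA.toIsCut
  le B hB := by
    have := hA.le _
      (g⁻¹.isCut_smul (g.rayEquiv_inv_mapRay h₁) (g.rayEquiv_inv_mapRay h₂) hB)
    simpa [outerBoundary_smul] using this

/-- The automorphisms that fix every end. -/
def endStabilizer (Γ : Digraph V) : Subgroup Γ.Aut := (MulAction.toPermHom Γ.Aut Γ.Ends).ker

theorem mem_endStabilizer {g : Γ.Aut} : g ∈ Γ.endStabilizer ↔ ∀ e : Γ.Ends, g • e = e := by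
  rw [endStabilizer, MonoidHom.mem_ker, Equiv.ext_iff]
  rfl

instance : Γ.endStabilizer.Normal := inferInstanceAs (MonoidHom.ker _).Normal

/-- The rays `R₁` and `R₂` represent the ends of `Γ`, which are exactly two. -/
structure EndPair (Γ : Digraph V) (R₁ R₂ : Γ.Ray) : Prop where
  not_equiv : ¬ Γ.RayEquiv R₁ R₂
  equiv : ∀ R, Γ.RayEquiv R R₁ ∨ Γ.RayEquiv R R₂

theorem TwoEnded.exists_endPair (h : Γ.TwoEnded) : ∃ R₁ R₂, Γ.EndPair R₁ R₂ := by
  obtain ⟨e₁, e₂, hne, huniv⟩ := Nat.card_eq_two_iff.1 h.2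
  induction e₁ using Quotient.inductionOn with | _ R₁
  induction e₂ using Quotient.inductionOn with | _ R₂
  refine ⟨R₁, R₂, fun h => hne (Quotient.sound h), fun R => ?_⟩
  have hR : (Quotient.mk Γ.raySetoid R) ∈ ({⟦R₁⟧, ⟦R₂⟧} : Set (Quotient Γ.raySetoid)) := by
    rw [show ({⟦R₁⟧, ⟦R₂⟧} : Set (Quotient Γ.raySetoid)) = Set.univ from huniv]
    trivial
  exact hR.imp (fun h => Quotient.exact h) fun h => Quotient.exact h

/-! ### Automorphisms acting on the two ends and on the minimum cuts. -/

namespace EndPair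

variable {R₁ R₂ : Γ.Ray}

theorem symm (hR : Γ.EndPair R₁ R₂) : Γ.EndPair R₂ R₁ :=
  ⟨fun h => hR.not_equiv (Γ.rayEquiv_symm h), fun R => (hR.equiv R).symm⟩

theorem rayEquiv_trichotomy (hR : Γ.EndPair R₁ R₂) (R S T : Γ.Ray) :
    Γ.RayEquiv R S ∨ Γ.RayEquiv R T ∨ Γ.RayEquiv S T := by
  have key : ∀ {R S U : Γ.Ray}, Γ.RayEquiv R U → Γ.RayEquiv S U → Γ.RayEquiv R S :=
    fun h₁ h₂ => Γ.rayEquiv_trans h₁ (Γ.rayEquiv_symm h₂)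
  rcases hR.equiv R with h₁ | h₁ <;> rcases hR.equiv S with h₂ | h₂ <;>
    rcases hR.equiv T with h₃ | h₃
  · exact .inl (key h₁ h₂)
  · exact .inl (key h₁ h₂)
  · exact .inr (.inl (key h₁ h₃))
  · exact .inr (.inr (key h₂ h₃))
  · exact .inr (.inr (key h₂ h₃))
  · exact .inr (.inl (key h₁ h₃))
  · exact .inl (key h₁ h₂)
  · exact .inl (key h₁ h₂)

theorem mapRay_equiv_of_mem {g : Γ.Aut} (hg : g ∈ Γ.endStabilizer) (R : Γ.Ray) :
    Γ.RayEquiv (g.mapRay R) R :=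
  Quotient.exact (mem_endStabilizer.1 hg (Quotient.mk Γ.raySetoid R))

theorem mapRay_equiv_of_notMem (hR : Γ.EndPair R₁ R₂) {g : Γ.Aut} (hg : g ∉ Γ.endStabilizer) :
    Γ.RayEquiv (g.mapRay R₁) R₂ := by
  refine (hR.equiv _).resolve_left fun h => hg (mem_endStabilizer.2 fun e => ?_)
  induction e using Quotient.inductionOn with | _ R
  refine Quotient.sound (s := Γ.raySetoid) ?_
  rcases hR.equiv R with h₁ | h₁
  · exact Γ.rayEquiv_trans (g.mapRay_equiv h₁) (Γ.rayEquiv_trans h (Γ.rayEquiv_symm h₁))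
  · rcases hR.equiv (g.mapRay R) with h₂ | h₂
    · have h₃ := Γ.rayEquiv_trans (Γ.rayEquiv_symm (g.rayEquiv_inv_mapRay h))
        (g.rayEquiv_inv_mapRay h₂)
      exact absurd (Γ.rayEquiv_trans h₃ h₁) hR.not_equiv
    · exact Γ.rayEquiv_trans h₂ (Γ.rayEquiv_symm h₁)

theorem mul_mem_endStabilizer (hR : Γ.EndPair R₁ R₂) {g h : Γ.Aut} (hg : g ∉ Γ.endStabilizer)
    (hh : h ∉ Γ.endStabilizer) : g * h ∈ Γ.endStabilizer := by
  by_contra hgh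
  have h₁ := hR.mapRay_equiv_of_notMem hgh
  have h₂ := Γ.rayEquiv_trans (g.mapRay_equiv (hR.mapRay_equiv_of_notMem hh))
    (hR.symm.mapRay_equiv_of_notMem hg)
  exact hR.not_equiv (Γ.rayEquiv_trans (Γ.rayEquiv_symm h₂) h₁)

theorem isMinCut_smul {g : Γ.Aut} (hg : g ∈ Γ.endStabilizer) {A : Set V}
    (hA : Γ.underlying.IsMinCut R₁.filter R₂.filter A) :
    Γ.underlying.IsMinCut R₁.filter R₂.filter (g • A) :=
  g.isMinCut_smul (mapRay_equiv_of_mem hg R₁) (mapRay_equiv_of_mem hg R₂) hA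

theorem isMinCut_outerSide_smul (hR : Γ.EndPair R₁ R₂) {g : Γ.Aut} (hg : g ∉ Γ.endStabilizer)
    {A : Set V} (hA : Γ.underlying.IsMinCut R₁.filter R₂.filter A) :
    Γ.underlying.IsMinCut R₁.filter R₂.filter (Γ.underlying.outerSide (g • A)) :=
  (g.isMinCut_smul (hR.mapRay_equiv_of_notMem hg) (hR.symm.mapRay_equiv_of_notMem hg) hA).outerSide
    R₂.filter_le_cofinite R₁.filter_le_cofinite

theorem outerBoundary_outerSide_smul (hR : Γ.EndPair R₁ R₂) {g : Γ.Aut}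
    (hg : g ∉ Γ.endStabilizer) {A : Set V}
    (hA : Γ.underlying.IsMinCut R₁.filter R₂.filter A) :
    Γ.underlying.outerBoundary (Γ.underlying.outerSide (g • A)) =
      g • Γ.underlying.outerBoundary A := by
  rw [← g.outerBoundary_smul]
  exact (g.isMinCut_smul (hR.mapRay_equiv_of_notMem hg)
    (hR.symm.mapRay_equiv_of_notMem hg) hA).outerBoundary_outerSide
      R₂.filter_le_cofinite R₁.filter_le_cofinite

theorem exists_isMinCut (hR : Γ.EndPair R₁ R₂) :
    ∃ A, Γ.underlying.IsMinCut R₁.filter R₂.filter A :=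
  let ⟨_, hA⟩ := exists_isCut hR.not_equiv
  hA.exists_isMinCut

/-- Translates of one minimum cut suffice; if the translation swaps the ends, `outerSide` restores
the orientation and keeps the boundary. -/
theorem exists_mem_outerBoundary (hR : Γ.EndPair R₁ R₂) (hΓ : Γ.IsConnected)
    (hv : Γ.VertexTransitive) (x : V) :
    ∃ B, Γ.underlying.IsMinCut R₁.filter R₂.filter B ∧ x ∈ Γ.underlying.outerBoundary B := by
  obtain ⟨A, hA⟩ := hR.exists_isMinCut
  obtain ⟨y, hy⟩ := hA.toIsCut.outerBoundary_nonempty hΓ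
  obtain ⟨g, rfl⟩ := hv y x
  have hgy : g • y ∈ g • Γ.underlying.outerBoundary A := Set.smul_mem_smul_set hy
  by_cases hg : g ∈ Γ.endStabilizer
  · exact ⟨_, isMinCut_smul hg hA, by rwa [g.outerBoundary_smul]⟩
  · exact ⟨_, hR.isMinCut_outerSide_smul hg hA, by rwa [hR.outerBoundary_outerSide_smul hg hA]⟩

/-- Otherwise only end-swapping automorphisms carry vertices of `A` to the outer side. Two of them
compose to an element of `endStabilizer` joining consecutive vertices of `R₁`; by arc-transitivity
and connectedness `endStabilizer` is then vertex-transitive, a contradiction. -/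
theorem exists_smul_eq_of_isMinCut (hR : Γ.EndPair R₁ R₂) (hΓ : Γ.IsConnected)
    (hv : Γ.VertexTransitive) (ha : Γ.ArcTransitive) {A : Set V}
    (hA : Γ.underlying.IsMinCut R₁.filter R₂.filter A) :
    ∃ x ∈ A, ∃ h ∈ Γ.endStabilizer, h • x ∈ Γ.underlying.outerSide A := by
  by_contra! hcon
  have hmul := @mul_mem_endStabilizer _ _ _ _ hR
  obtain ⟨n, hn⟩ := Ray.mem_filter.1 hA.mem
  obtain ⟨y, hy⟩ := nonempty_of_mem
    (hA.toIsCut.outerSide R₂.filter_le_cofinite).mem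
  have key : ∀ x ∈ A, ∃ g ∉ Γ.endStabilizer, g • x = y := by
    intro x hx
    obtain ⟨g, hg⟩ := hv x y
    exact ⟨g, fun h => hcon x hx g h (by rwa [show g • x = y from hg]), hg⟩
  obtain ⟨g₁, hg₁, h₁⟩ := key _ (hn n le_rfl)
  obtain ⟨g₂, hg₂, h₂⟩ := key _ (hn (n + 1) (by omega))
  set p := R₁.vert n
  set q := R₁.vert (n + 1)
  have hpq : ∃ h ∈ Γ.endStabilizer, h • p = q :=
    ⟨g₂⁻¹ * g₁, hmul (by simpa using hg₂) hg₁, by rw [mul_smul, h₁, ← h₂, inv_smul_smul]⟩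
  have hadj : ∀ c d, Γ.underlying.Adj c d → ∃ h ∈ Γ.endStabilizer, h • c = d := by
    have harc : ∀ {a b c d : V}, Γ.Adj a b → Γ.Adj c d → (∃ h ∈ Γ.endStabilizer, h • a = b) →
        ∃ h ∈ Γ.endStabilizer, h • c = d := by
      rintro a b c d hab hcd ⟨h, hh, rfl⟩
      obtain ⟨g, rfl, rfl⟩ := ha _ _ _ _ hab hcd
      refine ⟨g * h * g⁻¹, Subgroup.Normal.conj_mem inferInstance h hh g, ?_⟩
      change (g * h * g⁻¹) • (g • a) = g • (h • a)
      rw [mul_smul, mul_smul, inv_smul_smul]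
    have hsymm : ∀ {a b : V}, (∃ h ∈ Γ.endStabilizer, h • a = b) →
        ∃ h ∈ Γ.endStabilizer, h • b = a := by
      rintro a _ ⟨h, hh, rfl⟩
      exact ⟨h⁻¹, inv_mem hh, inv_smul_smul _ _⟩
    have hpq' : ∃ a b, Γ.Adj a b ∧ ∃ h ∈ Γ.endStabilizer, h • a = b := by
      rcases (underlying_adj_iff.1 (R₁.adj n)).2 with h | h
      exacts [⟨_, _, h, hpq⟩, ⟨_, _, h, hsymm hpq⟩]
    obtain ⟨a, b, hab, hab'⟩ := hpq'
    intro c d hcd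
    rcases (underlying_adj_iff.1 hcd).2 with h | h
    · exact harc hab h hab'
    · exact hsymm (harc hab h hab')
  have hpy : ∃ h ∈ Γ.endStabilizer, h • p = y := by
    have := SimpleGraph.Connected.eq_of_forall_adj hΓ
      (f := fun x => ∃ h ∈ Γ.endStabilizer, h • p = x) (fun x z hxz => propext ⟨?_, ?_⟩) p y
    · exact this ▸ ⟨1, one_mem _, one_smul _ _⟩
    · rintro ⟨h, hh, rfl⟩
      obtain ⟨k, hk, rfl⟩ := hadj _ _ hxz
      exact ⟨k * h, mul_mem hk hh, mul_smul _ _ _⟩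
    · rintro ⟨h, hh, rfl⟩
      obtain ⟨k, hk, rfl⟩ := hadj _ _ hxz.symm
      exact ⟨k * h, mul_mem hk hh, mul_smul _ _ _⟩
  obtain ⟨h, hh, rfl⟩ := hpy
  exact hcon p (hn n le_rfl) h hh hy

theorem finite_neighborSet (hR : Γ.EndPair R₁ R₂) (hΓ : Γ.IsConnected)
    (hv : Γ.VertexTransitive) (ha : Γ.ArcTransitive) (v : V) :
    (Γ.underlying.neighborSet v).Finite := by
  obtain ⟨A, hA⟩ := hR.exists_isMinCut
  obtain ⟨x, hx, h, hh, hhx⟩ := hR.exists_smul_eq_of_isMinCut hΓ hv ha hA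
  have hx' : x ∈ h⁻¹ • Γ.underlying.outerSide A := by
    rwa [Set.mem_smul_set_iff_inv_smul_mem, inv_inv]
  obtain ⟨g, rfl⟩ := hv x v
  have hgA : g • x ∈ g • A := Set.smul_mem_smul_set hx
  have hgh : g • x ∈ Γ.underlying.outerSide ((g * h⁻¹) • A) := by
    rw [(g * h⁻¹).outerSide_smul, mul_smul]
    exact Set.smul_mem_smul_set hx'
  have hcov := hR.exists_mem_outerBoundary hΓ hv
  by_cases hg : g ∈ Γ.endStabilizer
  · exact (isMinCut_smul hg hA).finite_neighborSet R₁.filter_le_cofinite hcov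
      (isMinCut_smul (mul_mem hg (inv_mem hh)) hA) hgA hgh
  -- When `g` swaps the ends, the two translated cuts exchange roles.
  · have hgh' : g * h⁻¹ ∉ Γ.endStabilizer := fun h' =>
      hg ((Subgroup.mul_mem_cancel_right _ (inv_mem hh)).1 h')
    exact (hR.isMinCut_outerSide_smul hgh' hA).finite_neighborSet R₁.filter_le_cofinite hcov
      (hR.isMinCut_outerSide_smul hg hA) hgh (SimpleGraph.subset_outerSide_outerSide _ hgA)

theorem commensurate (hR : Γ.EndPair R₁ R₂) (hΓ : Γ.IsConnected) (hv : Γ.VertexTransitive)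
    {A B : Set V} (hA : Γ.underlying.IsMinCut R₁.filter R₂.filter A)
    (hB : Γ.underlying.IsMinCut R₁.filter R₂.filter B) : Set.Commensurate A B :=
  have hcov := hR.exists_mem_outerBoundary hΓ hv
  ⟨hA.finite_diff R₁.filter_le_cofinite hcov hB, hB.finite_diff R₁.filter_le_cofinite hcov hA⟩

/-- The translation length may be computed on the minimum cut `outerSide (g • A)`, which is
commensurate to the complement of `g • A`; complements reverse the sign. -/
theorem relSize_smul_conj (hR : Γ.EndPair R₁ R₂) (hΓ : Γ.IsConnected) (hv : Γ.VertexTransitive)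
    {A : Set V} (hA : Γ.underlying.IsMinCut R₁.filter R₂.filter A) {g h : Γ.Aut}
    (hg : g ∉ Γ.endStabilizer) (hh : h ∈ Γ.endStabilizer) :
    Set.relSize A ((g * h * g⁻¹) • A) = - Set.relSize A (h • A) := by
  have hk : g * h * g⁻¹ ∈ Γ.endStabilizer := Subgroup.Normal.conj_mem inferInstance h hh g
  set k := g * h * g⁻¹ with hkdef
  have hB := hR.isMinCut_outerSide_smul hg hA
  set B := Γ.underlying.outerSide (g • A) with hBdef
  have hkB := isMinCut_smul hk hB
  have hcompl : Set.Commensurate B (g • A)ᶜ := by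
    refine ⟨Set.finite_empty.subset fun x hx => hx.2 fun hxA => hx.1 (.inl hxA),
      (hA.finite.smul_set (a := g)).subset fun x hx => ?_⟩
    rw [← g.outerBoundary_smul]
    by_contra hxN
    exact hx.2 (SimpleGraph.mem_outerSide.2 ⟨hx.1, hxN⟩)
  rw [Set.relSize_smul_congr (hR.commensurate hΓ hv hA hB)
      (hR.commensurate hΓ hv hA (isMinCut_smul hk hA)),
    Set.relSize_smul_congr hcompl (hR.commensurate hΓ hv hB hkB), Set.smul_set_compl,
    Set.relSize_compl, ← mul_smul, show k * g = g * h by rw [hkdef]; group, mul_smul,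
    Set.relSize_smul]

end EndPair

/-- A function on `Aut(Γ)` that is an epimorphism to `ℤ` on the stabilizer of the ends, is negated by
the conjugation with an automorphism that swaps the ends, and whose kernel has finite orbits. -/
structure IsTranslation (Γ : Digraph V) (τ : Γ.Aut → ℤ) : Prop where
  map_mul : ∀ g ∈ Γ.endStabilizer, ∀ h ∈ Γ.endStabilizer, τ (g * h) = τ g + τ h
  map_conj : ∀ g ∉ Γ.endStabilizer, ∀ h ∈ Γ.endStabilizer, τ (g * h * g⁻¹) = - τ h
  finite : ∀ v : V, {x | ∃ h ∈ Γ.endStabilizer, τ h = 0 ∧ h • v = x}.Finite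
  infinite : ∀ v : V, {x | ∃ h ∈ Γ.endStabilizer, h • v = x}.Infinite
  exists_eq_one : ∃ t ∈ Γ.endStabilizer, τ t = 1

theorem exists_isTranslation (hv : Γ.VertexTransitive) (ha : Γ.ArcTransitive)
    (hends : Γ.TwoEnded) : ∃ τ, Γ.IsTranslation τ := by
  obtain ⟨R₁, R₂, hR⟩ := hends.exists_endPair
  have hΓ := hends.1
  obtain ⟨A, hA⟩ := hR.exists_isMinCut
  set τ : Γ.Aut → ℤ := fun g => Set.relSize A (g • A) with hτ
  have hcomm : ∀ g ∈ Γ.endStabilizer, Set.Commensurate A (g • A) :=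
    fun g hg => hR.commensurate hΓ hv hA (EndPair.isMinCut_smul hg hA)
  have hmul : ∀ g ∈ Γ.endStabilizer, ∀ h ∈ Γ.endStabilizer, τ (g * h) = τ g + τ h := by
    intro g hg h hh
    simp only [hτ]
    rw [← Set.relSize_smul g A (h • A), mul_smul,
      Set.relSize_add (hcomm g hg) ((hcomm h hh).smul g)]
  have hball := SimpleGraph.Connected.finite_setOf_dist_le hΓ (hR.finite_neighborSet hΓ hv ha)
  have hbound : ∀ v, ∃ n, ∀ y ∈ Γ.underlying.outerBoundary A, Γ.underlying.dist v y ≤ n := by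
    intro v
    obtain ⟨n, hn⟩ := (hA.finite.image (Γ.underlying.dist v)).bddAbove
    exact ⟨n, fun y hy => hn (Set.mem_image_of_mem _ hy)⟩
  -- A longer displacement puts the two boundaries in disjoint balls, so the cuts are strictly
  -- nested and have nonzero relative size.
  have hfar : ∀ v n, (∀ y ∈ Γ.underlying.outerBoundary A, Γ.underlying.dist v y ≤ n) →
      ∀ g ∈ Γ.endStabilizer, τ g = 0 → Γ.underlying.dist v (g • v) ≤ 2 * n := by
    intro v n hn g hg h₀
    by_contra! hlt
    refine Set.relSize_ne_zero (hcomm g hg) ?_ h₀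
    refine hA.toIsCut.ssubset_or_ssubset_of_dist hΓ (EndPair.isMinCut_smul hg hA).toIsCut hn
      (fun y hy => ?_) hlt
    rw [g.outerBoundary_smul] at hy
    obtain ⟨z, hz, rfl⟩ := hy
    exact (g.dist_smul hΓ v z).trans_le (hn z hz)
  have hinf : ∀ v : V, {x | ∃ h ∈ Γ.endStabilizer, h • v = x}.Infinite := by
    intro v hfin
    have : Infinite V := Infinite.of_injective R₁.vert R₁.inj
    -- A representative of the nontrivial coset, if there is one: a finite orbit of `endStabilizer`
    -- would make `V` finite.
    obtain ⟨s, hs⟩ : ∃ s : Γ.Aut, ∀ g ∉ Γ.endStabilizer, s⁻¹ * g ∈ Γ.endStabilizer := by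
      by_cases h : ∃ s, s ∉ Γ.endStabilizer
      · obtain ⟨s, hs⟩ := h
        exact ⟨s, fun g hg => hR.mul_mem_endStabilizer (by simpa using hs) hg⟩
      · push Not at h
        exact ⟨1, fun g hg => absurd (h g) hg⟩
    refine Set.infinite_univ ((hfin.union (hfin.image fun x => s • x)).subset fun x _ => ?_)
    obtain ⟨g, rfl⟩ := hv v x
    by_cases hg : g ∈ Γ.endStabilizer
    · exact .inl ⟨g, hg, rfl⟩
    · exact .inr ⟨_, ⟨s⁻¹ * g, hs g hg, rfl⟩, by
        change s • (s⁻¹ * g) • v = g • v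
        rw [← mul_smul, mul_inv_cancel_left]⟩
  obtain ⟨t₀, ht₀, hτ₀⟩ : ∃ t ∈ Γ.endStabilizer, τ t ≠ 0 := by
    by_contra! h
    obtain ⟨v⟩ := hΓ.nonempty
    obtain ⟨n, hn⟩ := hbound v
    refine hinf v ((hball v (2 * n)).subset ?_)
    rintro _ ⟨g, hg, rfl⟩
    exact hfar v n hn g hg (h g hg)
  have hone : τ 1 = 0 := by
    have := hmul 1 (one_mem _) 1 (one_mem _)
    rw [mul_one] at this
    omega
  let S : AddSubgroup ℤ :=
    { carrier := {n | ∃ g ∈ Γ.endStabilizer, τ g = n}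
      add_mem' := by
        rintro _ _ ⟨g, hg, rfl⟩ ⟨h, hh, rfl⟩
        exact ⟨g * h, mul_mem hg hh, hmul g hg h hh⟩
      zero_mem' := ⟨1, one_mem _, hone⟩
      neg_mem' := by
        rintro _ ⟨g, hg, rfl⟩
        refine ⟨g⁻¹, inv_mem hg, ?_⟩
        have := hmul g hg g⁻¹ (inv_mem hg)
        rw [mul_inv_cancel, hone] at this
        omega }
  obtain ⟨a, hS⟩ := Int.subgroup_cyclic S
  have hdvd : ∀ g ∈ Γ.endStabilizer, a ∣ τ g := by
    intro g hg
    have : τ g ∈ S := ⟨g, hg, rfl⟩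
    rw [hS, AddSubgroup.mem_closure_singleton] at this
    obtain ⟨n, hn⟩ := this
    exact ⟨n, by rw [← hn, smul_eq_mul, mul_comm]⟩
  have ha₀ : a ≠ 0 := by
    rintro rfl
    exact hτ₀ (zero_dvd_iff.1 (hdvd t₀ ht₀))
  -- On `endStabilizer` the image of `τ` is `aℤ`, so the division is exact there and makes the map
  -- onto.
  refine ⟨fun g => τ g / a, fun g hg h hh => ?_, fun g hg h hh => ?_, fun v => ?_, hinf, ?_⟩
  · rw [hmul g hg h hh, Int.add_ediv_of_dvd_left (hdvd g hg)]
  · change Set.relSize A ((g * h * g⁻¹) • A) / a = _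
    rw [hR.relSize_smul_conj hΓ hv hA hg hh]
    exact Int.neg_ediv_of_dvd (hdvd h hh)
  · obtain ⟨n, hn⟩ := hbound v
    refine (hball v (2 * n)).subset ?_
    rintro _ ⟨g, hg, h₀, rfl⟩
    exact hfar v n hn g hg (Int.eq_zero_of_ediv_eq_zero (hdvd g hg) h₀)
  · have : a ∈ S := by
      rw [hS]
      exact AddSubgroup.mem_closure_singleton_self a
    obtain ⟨t, ht, h⟩ := this
    exact ⟨t, ht, by simp only [h]; exact Int.ediv_self ha₀⟩

end Digraph

theorem QuotientGroup.nonempty_mulEquiv_of_surjective {G H : Type*} [Group G] [Group H]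
    (φ : G →* H) (hφ : Function.Surjective φ) (N : Subgroup G) [N.Normal]
    (hN : ∀ g, φ g = 1 ↔ g ∈ N) : Nonempty (G ⧸ N ≃* H) := by
  obtain rfl : φ.ker = N := Subgroup.ext hN
  exact ⟨quotientKerEquivOfSurjective φ hφ⟩

namespace Digraph

variable {V : Type*} {Γ : Digraph V}

/-! ### Maps that identify the quotient by orbits -/

/-- The map `f` induces an isomorphism from `Γ / N` to `Δ`. -/
structure IsOrbitMap {W : Type*} (N : Subgroup Γ.Aut) (Δ : Digraph W) (f : V → W) : Prop where
  surjective : Function.Surjective f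
  eq_iff : ∀ v w, f v = f w ↔ ∃ n ∈ N, n • v = w
  adj_iff : ∀ i j, Δ.Adj i j ↔ ∃ v w, f v = i ∧ f w = j ∧ Γ.Adj v w

/-- Replaces the quotient digraph by a height function on `V`, the form used from here on. -/
theorem isomorphic_orbitQuotient_iff {W : Type*} {N : Subgroup Γ.Aut} {Δ : Digraph W} :
    (Γ.orbitQuotient N).Isomorphic Δ ↔ ∃ f : V → W, IsOrbitMap N Δ f := by
  have hrel : ∀ v w : V, MulAction.orbitRel N V v w ↔ ∃ n ∈ N, n • v = w := by
    intro v w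
    rw [Setoid.comm', MulAction.orbitRel_apply, MulAction.mem_orbit_iff]
    exact ⟨fun ⟨n, hn⟩ => ⟨n, n.2, hn⟩, fun ⟨n, hn, h⟩ => ⟨⟨n, hn⟩, h⟩⟩
  constructor
  · rintro ⟨φ⟩
    refine ⟨fun v => φ (Quotient.mk (MulAction.orbitRel N V) v), ?_, fun v w => ?_, fun i j => ?_⟩
    · exact φ.surjective.comp Quotient.mk_surjective
    · rw [← hrel, φ.injective.eq_iff]
      exact Quotient.eq (r := MulAction.orbitRel N V)
    · rw [← φ.apply_symm_apply i, ← φ.apply_symm_apply j, φ.map_rel_iff]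
      simp only [φ.injective.eq_iff]
      rfl
  · rintro ⟨f, hf⟩
    let F : Quotient (MulAction.orbitRel N V) → W :=
      Quotient.lift f fun v w h => (hf.eq_iff v w).2 ((hrel v w).1 h)
    have hF : Function.Bijective F := by
      refine ⟨fun A B => ?_, fun i => ?_⟩
      · induction A, B using Quotient.inductionOn₂ with | _ v w
        exact fun h => Quotient.sound (s := MulAction.orbitRel N V)
          ((hrel v w).2 ((hf.eq_iff v w).1 h))
      · obtain ⟨v, rfl⟩ := hf.surjective i
        exact ⟨Quotient.mk _ v, rfl⟩
    refine ⟨⟨Equiv.ofBijective F hF, fun {A B} => ?_⟩⟩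
    rw [hf.adj_iff]
    constructor
    · rintro ⟨v, w, hv, hw, h⟩
      exact ⟨v, w, hF.1 hv, hF.1 hw, h⟩
    · rintro ⟨v, w, rfl, rfl, h⟩
      exact ⟨v, w, rfl, rfl, h⟩

/-! ### The kernel of the translation length and the height function. -/

namespace IsTranslation

variable {τ : Γ.Aut → ℤ}

theorem map_one (hτ : Γ.IsTranslation τ) : τ 1 = 0 := by
  have := hτ.map_mul 1 (one_mem _) 1 (one_mem _)
  rw [mul_one] at this
  omega

theorem map_inv (hτ : Γ.IsTranslation τ) {g : Γ.Aut} (hg : g ∈ Γ.endStabilizer) :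
    τ g⁻¹ = - τ g := by
  have := hτ.map_mul g hg g⁻¹ (inv_mem hg)
  rw [mul_inv_cancel, hτ.map_one] at this
  omega

theorem map_pow (hτ : Γ.IsTranslation τ) {g : Γ.Aut} (hg : g ∈ Γ.endStabilizer) (n : ℕ) :
    τ (g ^ n) = n * τ g := by
  induction n with
  | zero => simp [hτ.map_one]
  | succ n ih =>
    rw [pow_succ, hτ.map_mul _ (pow_mem hg n) _ hg, ih]
    push_cast
    ring

theorem map_zpow (hτ : Γ.IsTranslation τ) {g : Γ.Aut} (hg : g ∈ Γ.endStabilizer) (n : ℤ) :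
    τ (g ^ n) = n * τ g := by
  obtain ⟨n, rfl | rfl⟩ := n.eq_nat_or_neg
  · rw [zpow_natCast, hτ.map_pow hg]
  · rw [zpow_neg, zpow_natCast, hτ.map_inv (pow_mem hg n), hτ.map_pow hg]
    ring

theorem exists_eq (hτ : Γ.IsTranslation τ) (n : ℤ) : ∃ t ∈ Γ.endStabilizer, τ t = n := by
  obtain ⟨t, ht, h⟩ := hτ.exists_eq_one
  exact ⟨t ^ n, zpow_mem ht n, by rw [hτ.map_zpow ht, h, mul_one]⟩

/-- The automorphisms that fix both ends and have translation length zero. -/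
def kernel (hτ : Γ.IsTranslation τ) : Subgroup Γ.Aut where
  carrier := {g | g ∈ Γ.endStabilizer ∧ τ g = 0}
  mul_mem' {g h} hg hh := ⟨mul_mem hg.1 hh.1, by rw [hτ.map_mul g hg.1 h hh.1, hg.2, hh.2, add_zero]⟩
  one_mem' := ⟨one_mem _, hτ.map_one⟩
  inv_mem' {g} hg := ⟨inv_mem hg.1, by rw [hτ.map_inv hg.1, hg.2, neg_zero]⟩

theorem mem_kernel (hτ : Γ.IsTranslation τ) {g : Γ.Aut} :
    g ∈ hτ.kernel ↔ g ∈ Γ.endStabilizer ∧ τ g = 0 := Iff.rfl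

instance kernel_normal (hτ : Γ.IsTranslation τ) : hτ.kernel.Normal where
  conj_mem n hn g := by
    refine ⟨Subgroup.Normal.conj_mem inferInstance n hn.1 g, ?_⟩
    by_cases hg : g ∈ Γ.endStabilizer
    · rw [hτ.map_mul _ (mul_mem hg hn.1) _ (inv_mem hg), hτ.map_mul _ hg _ hn.1, hτ.map_inv hg, hn.2]
      ring
    · rw [hτ.map_conj g hg n hn.1, hn.2, neg_zero]

theorem hasFiniteOrbits (hτ : Γ.IsTranslation τ) : Γ.HasFiniteOrbits hτ.kernel := by
  refine fun v => (hτ.finite v).subset ?_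
  rintro _ ⟨n, rfl⟩
  exact ⟨n, n.2.1, n.2.2, rfl⟩

/-- Powers of `h` fix `v`, so they reduce `τ g` modulo `τ h` without changing `g • v`. If `τ h ≠ 0`,
finitely many translates of a finite set would cover the infinite orbit of `v`. -/
theorem eq_zero_of_smul_eq (hτ : Γ.IsTranslation τ) {h : Γ.Aut} (hh : h ∈ Γ.endStabilizer) {v : V}
    (hv : h • v = v) : τ h = 0 := by
  by_contra hq
  choose t ht htn using hτ.exists_eq
  refine hτ.infinite v (((Finset.Ico 0 |τ h|).finite_toSet.biUnion fun r _ =>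
    (hτ.finite v).image fun x => t r • x).subset ?_)
  rintro _ ⟨g, hg, rfl⟩
  refine Set.mem_biUnion (x := τ g % τ h)
    (by simpa using ⟨Int.emod_nonneg _ hq, Int.emod_lt_abs _ hq⟩)
    ⟨(t (τ g % τ h))⁻¹ • g • v, ⟨(t (τ g % τ h))⁻¹ * (g * h ^ (-(τ g / τ h))), ?_, ?_, ?_⟩,
      smul_inv_smul _ _⟩
  · exact mul_mem (inv_mem (ht _)) (mul_mem hg (zpow_mem hh _))
  · rw [hτ.map_mul _ (inv_mem (ht _)) _ (mul_mem hg (zpow_mem hh _)),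
      hτ.map_mul _ hg _ (zpow_mem hh _), hτ.map_inv (ht _), hτ.map_zpow hh, htn]
    have := Int.emod_add_mul_ediv (τ g) (τ h)
    linarith
  · have hfix : h ^ (-(τ g / τ h)) • v = v :=
      zpow_mem (MulAction.mem_stabilizer_iff.2 hv : h ∈ MulAction.stabilizer Γ.Aut v) _
    rw [mul_smul, mul_smul, hfix]

/-- The height of `g • v₀` is `τ g`, well defined because `τ` vanishes on the vertex stabilizers in
`endStabilizer`. -/
theorem exists_height (hτ : Γ.IsTranslation τ)
    (hE : ∀ v w : V, ∃ g ∈ Γ.endStabilizer, g • v = w) (v₀ : V) :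
    ∃ f : V → ℤ, f v₀ = 0 ∧ ∀ g ∈ Γ.endStabilizer, ∀ x, f (g • x) = τ g + f x := by
  choose γ hγ hγv using hE v₀
  have key : ∀ g ∈ Γ.endStabilizer, τ (γ (g • v₀)) = τ g := by
    intro g hg
    have h := hτ.eq_zero_of_smul_eq (h := g⁻¹ * γ (g • v₀)) (mul_mem (inv_mem hg) (hγ _)) (v := v₀)
      (by rw [mul_smul, hγv, inv_smul_smul])
    rw [hτ.map_mul _ (inv_mem hg) _ (hγ _), hτ.map_inv hg] at h
    omega
  refine ⟨fun x => τ (γ x), ?_, fun g hg x => ?_⟩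
  · have := key 1 (one_mem _)
    rwa [one_smul, hτ.map_one] at this
  · have := key (g * γ x) (mul_mem hg (hγ x))
    rwa [mul_smul, hγv, hτ.map_mul g hg _ (hγ x)] at this

theorem height_eq_iff (hτ : Γ.IsTranslation τ)
    (hE : ∀ v w : V, ∃ g ∈ Γ.endStabilizer, g • v = w) {f : V → ℤ}
    (hf : ∀ g ∈ Γ.endStabilizer, ∀ x, f (g • x) = τ g + f x) (v w : V) :
    f v = f w ↔ ∃ n ∈ hτ.kernel, n • v = w := by
  constructor
  · intro h
    obtain ⟨g, hg, rfl⟩ := hE v w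
    exact ⟨g, ⟨hg, by have := hf g hg v; omega⟩, rfl⟩
  · rintro ⟨n, hn, rfl⟩
    rw [hf n hn.1, hn.2, zero_add]

theorem height_surjective [Nonempty V] (hτ : Γ.IsTranslation τ) {f : V → ℤ}
    (hf : ∀ g ∈ Γ.endStabilizer, ∀ x, f (g • x) = τ g + f x) : Function.Surjective f := by
  intro i
  obtain ⟨v⟩ := ‹Nonempty V›
  obtain ⟨t, ht, h⟩ := hτ.exists_eq (i - f v)
  exact ⟨t • v, by rw [hf t ht, h]; ring⟩

end IsTranslation

theorem IsConnected.exists_adj [Nontrivial V] (hΓ : Γ.IsConnected) : ∃ a b, Γ.Adj a b := by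
  by_contra! h
  obtain ⟨x, y, hxy⟩ := exists_pair_ne V
  exact hxy (SimpleGraph.Connected.eq_of_forall_adj hΓ (f := id)
    (fun a b hab => ((underlying_adj_iff.1 hab).2.elim (h a b) (h b a)).elim) x y)

/-- Modulo `c` the function is constant by connectedness, yet it takes the values 0 and 1. -/
theorem IsConnected.eq_one_or_neg_one (hΓ : Γ.IsConnected) {f : V → ℤ}
    (hf : Function.Surjective f) {c : ℤ} (hc : ∀ a b, Γ.Adj a b → c ∣ f b - f a) :
    c = 1 ∨ c = -1 := by
  obtain ⟨x, hx⟩ := hf 0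
  obtain ⟨y, hy⟩ := hf 1
  have h : f x % c = f y % c := by
    refine SimpleGraph.Connected.eq_of_forall_adj hΓ (f := fun x => f x % c) (fun a b hab => ?_) x y
    rcases (underlying_adj_iff.1 hab).2 with h | h
    · exact Int.modEq_iff_dvd.2 (hc _ _ h)
    · exact (Int.modEq_iff_dvd.2 (hc _ _ h)).symm
  have h' : c ∣ f y - f x := Int.modEq_iff_dvd.1 h
  rw [hx, hy, sub_zero] at h'
  exact Int.isUnit_iff.1 (isUnit_of_dvd_one h')

/-! ### The quotient digraph and the quotient group in the two cases. -/

namespace IsTranslation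

variable {τ : Γ.Aut → ℤ}

theorem directedCase (hτ : Γ.IsTranslation τ) (hΓ : Γ.IsConnected) (hv : Γ.VertexTransitive)
    (ha : Γ.ArcTransitive) (hG : ∀ g, g ∈ Γ.endStabilizer) : Γ.DirectedCase hτ.kernel := by
  have hE : ∀ v w : V, ∃ g ∈ Γ.endStabilizer, g • v = w := fun v w =>
    (hv v w).imp fun g h => ⟨hG g, h⟩
  have : Nonempty V := hΓ.nonempty
  obtain ⟨v₀⟩ := this
  have : Nonempty V := ⟨v₀⟩
  obtain ⟨f, -, hf⟩ := hτ.exists_height hE v₀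
  have hsurj := hτ.height_surjective hf
  have : Nontrivial V := hsurj.nontrivial
  obtain ⟨a, b, hab⟩ := hΓ.exists_adj
  have hc : ∀ v w, Γ.Adj v w → f w - f v = f b - f a := by
    intro v w hvw
    obtain ⟨g, rfl, rfl⟩ := ha _ _ _ _ hab hvw
    have h₁ := hf g (hG g) a
    have h₂ := hf g (hG g) b
    change f (g • b) - f (g • a) = _
    omega
  have hc1 := hΓ.eq_one_or_neg_one hsurj fun v w h => (hc v w h).symm.dvd
  set c := f b - f a with hcdef
  have hcc : c * c = 1 := by rcases hc1 with h | h <;> rw [h] <;> rfl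
  have hinj : ∀ {m n : ℤ}, c * m = c * n → m = n := fun {m n} h => by
    have := congrArg (c * ·) h
    simpa only [← mul_assoc, hcc, one_mul] using this
  constructor
  -- The factor `c = ±1` makes every arc go up.
  · refine isomorphic_orbitQuotient_iff.2 ⟨fun x => c * f x, fun i => ?_, fun v w => ?_,
      fun i j => ⟨?_, ?_⟩⟩
    · obtain ⟨x, hx⟩ := hsurj (c * i)
      exact ⟨x, by simp only [hx, ← mul_assoc, hcc, one_mul]⟩
    · rw [← hτ.height_eq_iff hE hf]
      exact ⟨hinj, fun h => by rw [h]⟩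
    · rintro (rfl : j = i + 1)
      obtain ⟨t, ht, h⟩ := hτ.exists_eq (c * i - f a)
      have h₁ : f (t • a) = c * i := by rw [hf t ht, h]; ring
      have h₂ : f (t • b) = c * i + c := by rw [hf t ht, h, hcdef]; ring
      refine ⟨t • a, t • b, ?_, ?_, (Aut.adj_smul_iff t).2 hab⟩
      · simp only [h₁, ← mul_assoc, hcc, one_mul]
      · simp only [h₂, mul_add, ← mul_assoc, hcc, one_mul]
    · rintro ⟨v, w, rfl, rfl, h⟩
      change c * f w = c * f v + 1
      have := hc v w h
      rw [← hcc, ← mul_add]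
      congr 1
      omega
  · refine QuotientGroup.nonempty_mulEquiv_of_surjective
      (MonoidHom.mk' (fun g => Multiplicative.ofAdd (τ g)) fun g h => ?_) (fun n => ?_) _ fun g => ?_
    · rw [hτ.map_mul g (hG g) h (hG h), ofAdd_add]
    · obtain ⟨t, -, h⟩ := hτ.exists_eq n.toAdd
      exact ⟨t, by simp [h]⟩
    · rw [hτ.mem_kernel]
      simp [hG g]

theorem nonempty_mulEquiv_dihedralGroup (hτ : Γ.IsTranslation τ) {R₁ R₂ : Γ.Ray}
    (hR : Γ.EndPair R₁ R₂) {s : Γ.Aut} (hs : s ∉ Γ.endStabilizer) :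
    Nonempty (Γ.Aut ⧸ hτ.kernel ≃* DihedralGroup 0) := by
  classical
  obtain ⟨ι⟩ : Nonempty (ℤ ≃+ ZMod 0) := ⟨AddEquiv.refl ℤ⟩
  have hs' : s⁻¹ ∉ Γ.endStabilizer := by simpa using hs
  have hmem : ∀ {g}, g ∉ Γ.endStabilizer → s⁻¹ * g ∈ Γ.endStabilizer := fun hg =>
    hR.mul_mem_endStabilizer hs' hg
  have hss := hR.mul_mem_endStabilizer hs hs
  -- Conjugation by `s` fixes `s * s` and also negates its length.
  have hss₀ : τ (s * s) = 0 := by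
    have := hτ.map_conj s hs _ hss
    rw [show s * (s * s) * s⁻¹ = s * s by group] at this
    omega
  refine QuotientGroup.nonempty_mulEquiv_of_surjective
    (MonoidHom.mk' (fun g => if g ∈ Γ.endStabilizer then DihedralGroup.r (ι (τ g))
      else DihedralGroup.sr (ι (τ (s⁻¹ * g)))) fun g h => ?_) (fun x => ?_) _ fun g => ?_
  · by_cases hg : g ∈ Γ.endStabilizer <;> by_cases hh : h ∈ Γ.endStabilizer
    · rw [if_pos (mul_mem hg hh), if_pos hg, if_pos hh, hτ.map_mul g hg h hh, DihedralGroup.r_mul_r]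
      rw [_root_.map_add]
    · rw [if_neg fun h' => hh ((Subgroup.mul_mem_cancel_left _ hg).1 h'), if_pos hg, if_neg hh,
        DihedralGroup.r_mul_sr, show s⁻¹ * (g * h) = (s⁻¹ * g * s⁻¹⁻¹) * (s⁻¹ * h) by group,
        hτ.map_mul _ (Subgroup.Normal.conj_mem inferInstance g hg _) _ (hmem hh),
        hτ.map_conj _ hs' g hg]
      congr 1
      simp only [_root_.map_add, _root_.map_neg]
      ring
    · rw [if_neg fun h' => hg ((Subgroup.mul_mem_cancel_right _ hh).1 h'), if_neg hg, if_pos hh,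
        DihedralGroup.sr_mul_r, ← mul_assoc, hτ.map_mul _ (hmem hg) _ hh]
      rw [_root_.map_add]
    · have hc : s * (s⁻¹ * g) * s⁻¹ ∈ Γ.endStabilizer :=
        Subgroup.Normal.conj_mem inferInstance _ (hmem hg) _
      rw [if_pos (hR.mul_mem_endStabilizer hg hh), if_neg hg, if_neg hh, DihedralGroup.sr_mul_sr,
        show g * h = (s * (s⁻¹ * g) * s⁻¹) * (s * s * (s⁻¹ * h)) by group,
        hτ.map_mul _ hc _ (mul_mem hss (hmem hh)), hτ.map_mul _ hss _ (hmem hh), hss₀,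
        hτ.map_conj _ hs _ (hmem hg)]
      congr 1
      simp only [_root_.map_add, _root_.map_neg, _root_.map_zero]
      ring
  · rcases x with i | i <;> obtain ⟨n, rfl⟩ := ι.surjective i <;>
      obtain ⟨t, ht, rfl⟩ := hτ.exists_eq n
    · exact ⟨t, by simp [ht]⟩
    · have : s * t ∉ Γ.endStabilizer := fun h' => hs ((Subgroup.mul_mem_cancel_right _ ht).1 h')
      exact ⟨s * t, by simp [this]⟩
  · rw [hτ.mem_kernel]
    rw [DihedralGroup.one_def]
    by_cases hg : g ∈ Γ.endStabilizer
    · rw [MonoidHom.mk'_apply, if_pos hg, DihedralGroup.r.injEq, _root_.map_eq_zero_iff ι ι.injective]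
      exact (and_iff_right hg).symm
    · rw [MonoidHom.mk'_apply, if_neg hg]
      exact ⟨fun h => (by cases h), fun h => absurd h.1 hg⟩

/-- If this failed, all vertex stabilizers would lie in the kernel. Arc-transitivity and
connectedness would then make the quotient by the kernel cyclic, generated by an automorphism `u`
carrying the tail of an arc to its head; but `s` inverts translations modulo the kernel. -/
theorem smul_surjective_of_notMem (hτ : Γ.IsTranslation τ) {R₁ R₂ : Γ.Ray}
    (hR : Γ.EndPair R₁ R₂) (hΓ : Γ.IsConnected) (hv : Γ.VertexTransitive) (ha : Γ.ArcTransitive)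
    {s : Γ.Aut} (hs : s ∉ Γ.endStabilizer) (v w : V) : ∃ g ∈ Γ.endStabilizer, g • v = w := by
  by_contra! hcon
  have hstab : ∀ (k : Γ.Aut) (x : V), k • x = x → k ∈ hτ.kernel := by
    intro k x hk
    have hkE : k ∈ Γ.endStabilizer := by
      by_contra hkE
      have htrans : ∀ y, ∃ g ∈ Γ.endStabilizer, g • x = y := by
        intro y
        obtain ⟨g, hg⟩ := hv x y
        by_cases hgE : g ∈ Γ.endStabilizer
        · exact ⟨g, hgE, hg⟩
        · exact ⟨g * k, hR.mul_mem_endStabilizer hgE hkE, by rw [mul_smul, hk]; exact hg⟩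
      obtain ⟨g, hg, rfl⟩ := htrans v
      obtain ⟨h, hh, rfl⟩ := htrans w
      exact hcon (h * g⁻¹) (mul_mem hh (inv_mem hg)) (by rw [mul_smul, inv_smul_smul])
    exact ⟨hkE, hτ.eq_zero_of_smul_eq hkE hk⟩
  have : Infinite V := Infinite.of_injective R₁.vert R₁.inj
  obtain ⟨a, b, hab⟩ := hΓ.exists_adj
  obtain ⟨u, rfl⟩ := hv a b
  let π : Γ.Aut →* Γ.Aut ⧸ hτ.kernel := QuotientGroup.mk' hτ.kernel
  have hπ : ∀ {g h : Γ.Aut}, g • a = h • a → π g = π h := by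
    intro g h hgh
    refine QuotientGroup.eq.2 (hstab _ a ?_)
    rw [mul_smul, ← hgh, inv_smul_smul]
  have hadj : ∀ x y, Γ.Adj x y →
      ((∃ g, g • a = x ∧ ∃ n : ℤ, π g = π u ^ n) ↔ ∃ g, g • a = y ∧ ∃ n : ℤ, π g = π u ^ n) := by
    intro x y hxy
    obtain ⟨k, rfl, rfl⟩ := ha _ _ _ _ hab hxy
    constructor
    · rintro ⟨g, hg, n, hn⟩
      have hkg : π k = π g := hπ hg.symm
      exact ⟨k * u, mul_smul _ _ _, n + 1, by rw [_root_.map_mul, hkg, hn, zpow_add_one]⟩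
    · rintro ⟨g, hg, n, hn⟩
      have hkg : π (k * u) = π g := hπ ((mul_smul _ _ _).trans hg.symm)
      refine ⟨k, rfl, n - 1, ?_⟩
      rw [zpow_sub_one, ← hn, ← hkg, _root_.map_mul, mul_inv_cancel_right]
  have hcyc : ∀ g : Γ.Aut, ∃ n : ℤ, π g = π u ^ n := by
    intro g
    have := SimpleGraph.Connected.eq_of_forall_adj hΓ
      (f := fun x => ∃ g : Γ.Aut, g • a = x ∧ ∃ n : ℤ, π g = π u ^ n) (fun x y hxy => propext ?_)
      a (g • a)
    · obtain ⟨h, hh, n, hn⟩ :=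
        this ▸ (⟨1, one_smul _ _, 0, by simp⟩ : ∃ g : Γ.Aut, g • a = a ∧ ∃ n : ℤ, π g = π u ^ n)
      exact ⟨n, (hπ hh).symm.trans hn⟩
    · rcases (underlying_adj_iff.1 hxy).2 with h | h
      exacts [hadj _ _ h, (hadj _ _ h).symm]
  obtain ⟨t, ht, ht₁⟩ := hτ.exists_eq_one
  obtain ⟨i, hi⟩ := hcyc s
  obtain ⟨j, hj⟩ := hcyc t
  have hst : s * t * s⁻¹ * t⁻¹ ∈ hτ.kernel := by
    refine (QuotientGroup.eq_one_iff (N := hτ.kernel) _).1 ?_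
    change π (s * t * s⁻¹ * t⁻¹) = 1
    rw [_root_.map_mul, _root_.map_mul, _root_.map_mul, _root_.map_inv, _root_.map_inv, hi, hj]
    group
  -- The commutator of `s` with a translation of length 1 has length -2, not 0.
  have h₂ := hst.2
  rw [hτ.map_mul _ (Subgroup.Normal.conj_mem inferInstance t ht s) _ (inv_mem ht),
    hτ.map_conj s hs t ht, hτ.map_inv ht, ht₁] at h₂
  omega

theorem undirectedCase (hτ : Γ.IsTranslation τ) {R₁ R₂ : Γ.Ray}
    (hR : Γ.EndPair R₁ R₂) (hΓ : Γ.IsConnected) (hv : Γ.VertexTransitive) (ha : Γ.ArcTransitive)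
    {s₀ : Γ.Aut} (hs₀ : s₀ ∉ Γ.endStabilizer) : Γ.UndirectedCase hτ.kernel := by
  refine ⟨?_, hτ.nonempty_mulEquiv_dihedralGroup hR hs₀⟩
  have hE := hτ.smul_surjective_of_notMem hR hΓ hv ha hs₀
  have : Infinite V := Infinite.of_injective R₁.vert R₁.inj
  obtain ⟨a, b, hab⟩ := hΓ.exists_adj
  obtain ⟨f, hf₀, hf⟩ := hτ.exists_height hE a
  have hsurj := hτ.height_surjective hf
  obtain ⟨k, hk, hka⟩ := hE (s₀ • a) a
  -- A swap fixing the vertex of height 0 acts on heights by negation.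
  obtain ⟨s, hs, hsa⟩ : ∃ s, s ∉ Γ.endStabilizer ∧ s • a = a :=
    ⟨k * s₀, fun h => hs₀ ((Subgroup.mul_mem_cancel_left _ hk).1 h), by rw [mul_smul, hka]⟩
  have hfs : ∀ x, f (s • x) = - f x := by
    intro x
    obtain ⟨g, hg, rfl⟩ := hE a x
    have h := hf _ (Subgroup.Normal.conj_mem inferInstance g hg s) (s • a)
    rw [hτ.map_conj s hs g hg, ← mul_smul, inv_mul_cancel_right, hsa, hf₀] at h
    rw [← mul_smul, h, hf g hg, hf₀]
    ring
  have hc : ∀ v w, Γ.Adj v w → f w - f v = f b - f a ∨ f w - f v = -(f b - f a) := by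
    intro v w hvw
    obtain ⟨g, rfl, rfl⟩ := ha _ _ _ _ hab hvw
    change f (g • b) - f (g • a) = _ ∨ f (g • b) - f (g • a) = _
    by_cases hg : g ∈ Γ.endStabilizer
    · left
      rw [hf g hg, hf g hg]
      ring
    · right
      have hgs : g * s⁻¹ ∈ Γ.endStabilizer := hR.mul_mem_endStabilizer hg (by simpa using hs)
      have key : ∀ x, f (g • x) = τ (g * s⁻¹) - f x := by
        intro x
        have := hf _ hgs (s • x)
        rwa [← mul_smul, inv_mul_cancel_right, hfs, ← sub_eq_add_neg] at this
      rw [key, key]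
      ring
  have hc1 := hΓ.eq_one_or_neg_one hsurj (c := f b - f a) fun v w h => by
    rcases hc v w h with h | h
    · exact h.symm.dvd
    · exact h ▸ dvd_neg.2 dvd_rfl
  refine isomorphic_orbitQuotient_iff.2
    ⟨f, hsurj, hτ.height_eq_iff hE hf, fun i j => ⟨fun h => ?_, ?_⟩⟩
  · have hij : j - i = f b - f a ∨ j - i = -(f b - f a) := by
      rcases h with h | h <;> omega
    rcases hij with hij | hij
    · obtain ⟨t, ht, h⟩ := hτ.exists_eq (i - f a)
      refine ⟨t • a, t • b, ?_, ?_, (Aut.adj_smul_iff t).2 hab⟩ <;> rw [hf t ht, h] <;> omega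
    · obtain ⟨t, ht, h⟩ := hτ.exists_eq (i + f a)
      refine ⟨t • s • a, t • s • b, ?_, ?_,
        (Aut.adj_smul_iff t).2 ((Aut.adj_smul_iff s).2 hab)⟩ <;> rw [hf t ht, h, hfs] <;> omega
  · rintro ⟨v, w, rfl, rfl, h⟩
    have := hc v w h
    change f w = f v + 1 ∨ f v = f w + 1
    omega

end IsTranslation

theorem exists_undirectedCase_or_directedCase (hv : Γ.VertexTransitive) (ha : Γ.ArcTransitive)
    (hends : Γ.TwoEnded) : ∃ (N : Subgroup Γ.Aut) (_ : N.Normal),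
      Γ.HasFiniteOrbits N ∧ (Γ.UndirectedCase N ∨ Γ.DirectedCase N) := by
  obtain ⟨τ, hτ⟩ := exists_isTranslation hv ha hends
  obtain ⟨R₁, R₂, hR⟩ := hends.exists_endPair
  refine ⟨hτ.kernel, inferInstance, hτ.hasFiniteOrbits, ?_⟩
  by_cases hG : ∀ g, g ∈ Γ.endStabilizer
  · exact .inr (hτ.directedCase hends.1 hv ha hG)
  · push Not at hG
    obtain ⟨s, hs⟩ := hG
    exact .inl (hτ.undirectedCase hR hends.1 hv ha hs)

end Digraph

namespace Digraph

open Pointwise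

variable {V : Type*} {Γ : Digraph V}

/-! ### Property Z -/

theorem DirectedCase.propertyZ {N : Subgroup Γ.Aut} [N.Normal] (h : Γ.DirectedCase N)
    (hΓ : Γ.IsConnected) : Γ.PropertyZ := by
  obtain ⟨f, hf⟩ := isomorphic_orbitQuotient_iff.1 h.1
  exact ⟨hΓ, f, hf.surjective, fun v w hvw => (hf.adj_iff _ _).2 ⟨v, w, rfl, rfl, hvw⟩⟩

/-- The difference `φ (g • v) - φ v` does not change along an edge, so every automorphism translates
`φ`. -/
theorem IsHom.exists_map_smul {φ : V → ℤ} (hφ : Γ.IsHom directedLine φ) (hΓ : Γ.IsConnected) :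
    ∃ ψ : Γ.Aut →* Multiplicative ℤ, ∀ (g : Γ.Aut) (v : V), φ (g • v) = (ψ g).toAdd + φ v := by
  obtain ⟨v₀⟩ := hΓ.nonempty
  have hφ' : ∀ {v w}, Γ.Adj v w → φ w = φ v + 1 := fun h => hφ _ _ h
  have key : ∀ (g : Γ.Aut) (v : V), φ (g • v) = (φ (g • v₀) - φ v₀) + φ v := by
    intro g v
    have := SimpleGraph.Connected.eq_of_forall_adj hΓ (f := fun v => φ (g • v) - φ v)
      (fun x y hxy => ?_) v v₀
    · omega
    · rcases (underlying_adj_iff.1 hxy).2 with h | h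
      all_goals
        have h₁ := hφ' h
        have h₂ := hφ' ((Aut.adj_smul_iff g).2 h)
        omega
  refine ⟨MonoidHom.mk' (fun g => Multiplicative.ofAdd (φ (g • v₀) - φ v₀)) fun g h => ?_, key⟩
  rw [← ofAdd_add]
  congr 1
  rw [mul_smul, key g (h • v₀)]
  ring

theorem HasFiniteOrbits.map_eq_one {N : Subgroup Γ.Aut} (hN : Γ.HasFiniteOrbits N) {φ : V → ℤ}
    {ψ : Γ.Aut →* Multiplicative ℤ} (hψ : ∀ (g : Γ.Aut) (v : V), φ (g • v) = (ψ g).toAdd + φ v)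
    (v : V) {n : Γ.Aut} (hn : n ∈ N) : ψ n = 1 := by
  have hfin : (Set.range fun k : ℕ => n ^ k • v).Finite := by
    refine (hN v).subset ?_
    rintro _ ⟨k, rfl⟩
    exact ⟨⟨n ^ k, pow_mem hn k⟩, rfl⟩
  obtain ⟨i, j, hij, h⟩ : ∃ i j : ℕ, i ≠ j ∧ n ^ i • v = n ^ j • v := by
    by_contra! hcon
    exact Set.infinite_range_of_injective
      (fun i j h => by_contra fun hij => hcon i j hij h) hfin
  have h' := congrArg φ h
  rw [hψ, hψ, map_pow ψ, map_pow ψ, toAdd_pow, toAdd_pow, add_left_inj, nsmul_eq_mul, nsmul_eq_mul] at h'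
  have hz : (ψ n).toAdd = 0 := by
    by_contra hne
    exact hij (by exact_mod_cast mul_right_cancel₀ hne h')
  exact hz

/-- The induced map to `ℤ` factors through a group generated by involutions, hence is trivial; then
`φ` is constant on the single vertex orbit. -/
theorem UndirectedCase.not_propertyZ {N : Subgroup Γ.Aut} [N.Normal] (h : Γ.UndirectedCase N)
    (hN : Γ.HasFiniteOrbits N) (hv : Γ.VertexTransitive) : ¬ Γ.PropertyZ := by
  rintro ⟨hΓ, φ, hsurj, hφ⟩
  obtain ⟨ψ, hψ⟩ := hφ.exists_map_smul hΓ
  obtain ⟨v₀⟩ := hΓ.nonempty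
  obtain ⟨e⟩ := h.2
  have hker : ∀ n ∈ N, ψ n = 1 := fun n hn => hN.map_eq_one hψ v₀ hn
  let ψ' : DihedralGroup 0 →* Multiplicative ℤ :=
    (QuotientGroup.lift N ψ hker).comp e.symm.toMonoidHom
  have hψ' : ∀ g, ψ g = ψ' (e g) := fun g =>
    (congrArg (QuotientGroup.lift N ψ hker) (e.symm_apply_apply (g : Γ.Aut ⧸ N))).symm
  have hsr : ∀ i, ψ' (.sr i) = 1 := by
    intro i
    have h₁ : ψ' (.sr i) * ψ' (.sr i) = 1 := by
      rw [← map_mul, DihedralGroup.sr_mul_self, map_one]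
    have h₂ : (ψ' (.sr i)).toAdd + (ψ' (.sr i)).toAdd = 0 := h₁
    have h₃ : (ψ' (.sr i)).toAdd = 0 := by omega
    exact h₃
  have htriv : ∀ x, ψ' x = 1 := by
    rintro (i | i)
    · rw [show DihedralGroup.r i = .sr 0 * .sr i by simp, map_mul, hsr, hsr, one_mul]
    · exact hsr i
  obtain ⟨w, hw⟩ := hsurj (φ v₀ + 1)
  obtain ⟨g, rfl⟩ := hv v₀ w
  have := hψ g v₀
  rw [hψ', htriv, toAdd_one] at this
  change φ (g • v₀) = _ at hw
  omega

/-! ### Lifting arcs from the quotient, and 2-arc-transitivity. -/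

namespace IsOrbitMap

variable {W : Type*} {N : Subgroup Γ.Aut} {Δ : Digraph W} {f : V → W}

theorem smul_congr [N.Normal] (hf : IsOrbitMap N Δ f) (g : Γ.Aut) {v w : V} :
    f (g • v) = f (g • w) ↔ f v = f w := by
  have key : ∀ (g : Γ.Aut) {v w : V}, f v = f w → f (g • v) = f (g • w) := by
    intro g v w h
    obtain ⟨n, hn, rfl⟩ := (hf.eq_iff v w).1 h
    refine (hf.eq_iff _ _).2 ⟨g * n * g⁻¹, Subgroup.Normal.conj_mem inferInstance n hn g, ?_⟩
    rw [← mul_smul, ← mul_smul, inv_mul_cancel_right]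
  exact ⟨fun h => by simpa using key g⁻¹ h, key g⟩

theorem map_adj (hf : IsOrbitMap N Δ f) {v w : V} (h : Γ.Adj v w) : Δ.Adj (f v) (f w) :=
  (hf.adj_iff _ _).2 ⟨v, w, rfl, rfl, h⟩

theorem exists_adj_right (hf : IsOrbitMap N Δ f) {v : V} {j : W} (h : Δ.Adj (f v) j) :
    ∃ w, Γ.Adj v w ∧ f w = j := by
  obtain ⟨v', w, hv, rfl, hvw⟩ := (hf.adj_iff _ _).1 h
  obtain ⟨n, hn, rfl⟩ := (hf.eq_iff _ _).1 hv
  exact ⟨n • w, (Aut.adj_smul_iff n).2 hvw, ((hf.eq_iff _ _).2 ⟨n, hn, rfl⟩).symm⟩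

theorem exists_adj_left (hf : IsOrbitMap N Δ f) {v : V} {j : W} (h : Δ.Adj j (f v)) :
    ∃ w, Γ.Adj w v ∧ f w = j := by
  obtain ⟨w, v', rfl, hv, hvw⟩ := (hf.adj_iff _ _).1 h
  obtain ⟨n, hn, rfl⟩ := (hf.eq_iff _ _).1 hv
  exact ⟨n • w, (Aut.adj_smul_iff n).2 hvw, ((hf.eq_iff _ _).2 ⟨n, hn, rfl⟩).symm⟩

theorem finite_fiber (hf : IsOrbitMap N Δ f) (hN : Γ.HasFiniteOrbits N) (i : W) :
    {v | f v = i}.Finite := by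
  obtain ⟨v, rfl⟩ := hf.surjective i
  refine (hN v).subset fun w hw => ?_
  obtain ⟨n, hn, rfl⟩ := (hf.eq_iff v w).1 (Eq.symm hw)
  exact ⟨⟨n, hn⟩, rfl⟩

end IsOrbitMap

theorem UndirectedCase.not_kArcTransitive {N : Subgroup Γ.Aut} [N.Normal]
    (h : Γ.UndirectedCase N) : ¬ Γ.KArcTransitive 2 := by
  intro h2
  obtain ⟨f, hf⟩ := isomorphic_orbitQuotient_iff.1 h.1
  obtain ⟨u, hu⟩ := hf.surjective 0
  obtain ⟨v, huv, hv⟩ := hf.exists_adj_right (v := u) (j := 1) (by rw [hu]; exact .inl rfl)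
  obtain ⟨w, hvw, hw⟩ := hf.exists_adj_right (v := v) (j := 2) (by rw [hv]; exact .inl rfl)
  obtain ⟨x, hvx, hx⟩ := hf.exists_adj_right (v := v) (j := 0) (by rw [hv]; exact .inr rfl)
  -- The ends `u`, `x` of the first 2-arc share an orbit, while `u`, `w` do not.
  obtain ⟨g, hg⟩ := h2 ![u, v, x] ![u, v, w]
    (Fin.forall_fin_two.2 ⟨huv, hvx⟩) (Fin.forall_fin_two.2 ⟨huv, hvw⟩)
  have h₀ : g • u = u := hg 0
  have h₁ : g • x = w := hg 2
  have := (hf.smul_congr g).2 (hu.trans hx.symm)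
  rw [h₀, h₁, hu, hw] at this
  exact absurd this (by decide)

/-! ### The action on the ends -/

theorem finite_outerBoundary_setOf_le {f : V → ℤ}
    (hf : ∀ x y, Γ.underlying.Adj x y → f y = f x + 1 ∨ f x = f y + 1)
    (hfin : ∀ i, {v | f v = i}.Finite) (i : ℤ) :
    (Γ.underlying.outerBoundary {v | i ≤ f v}).Finite := by
  refine (hfin (i - 1)).subset ?_
  rintro y ⟨hy, x, hx, hxy⟩
  simp only [Set.mem_ofPred_eq, not_le] at hx hy ⊢
  have := hf x y hxy
  omega

theorem UndirectedCase.exists_smul_eq {N : Subgroup Γ.Aut} [N.Normal] (h : Γ.UndirectedCase N)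
    (hN : Γ.HasFiniteOrbits N) (ha : Γ.ArcTransitive) (hends : Γ.TwoEnded) (e e' : Γ.Ends) :
    ∃ g : Γ.Aut, g • e = e' := by
  obtain ⟨f, hf⟩ := isomorphic_orbitQuotient_iff.1 h.1
  obtain ⟨R₁, R₂, hR⟩ := hends.exists_endPair
  have hadj : ∀ x y, Γ.underlying.Adj x y → f y = f x + 1 ∨ f x = f y + 1 := by
    intro x y hxy
    rcases (underlying_adj_iff.1 hxy).2 with h | h
    · exact hf.map_adj h
    · exact (hf.map_adj h).symm
  have hbd := finite_outerBoundary_setOf_le hadj (hf.finite_fiber hN)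
  obtain ⟨v, w, hv, hw, hvw⟩ := (hf.adj_iff 0 1).1 (.inl rfl)
  obtain ⟨v', w', hv', hw', hvw'⟩ := (hf.adj_iff 1 0).1 (.inr rfl)
  -- This `g` exchanges the fibres over 0 and 1, so it must act on heights as `i ↦ 1 - i` and swap
  -- the ends.
  obtain ⟨g, rfl, rfl⟩ := ha _ _ _ _ hvw hvw'
  change f (g • v) = 1 at hv'
  change f (g • w) = 0 at hw'
  -- Two consecutive fibres are carried along: the next image is adjacent to the nearer one and
  -- distinct from the farther one, which determines it.
  have hstep : ∀ i : ℤ, (∀ x, f x = i → f (g • x) = 1 - i) ∧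
      ∀ x, f x = i + 1 → f (g • x) = - i := by
    intro i
    induction i using Int.induction_on with
    | zero =>
      refine ⟨fun x hx => ?_, fun x hx => ?_⟩
      · rw [(hf.smul_congr g).2 (hx.trans hv.symm), hv']
        rfl
      · rw [(hf.smul_congr g).2 (hx.trans hw.symm), hw']
        rfl
    | succ i ih =>
      refine ⟨fun x hx => by rw [ih.2 x hx]; ring, fun x hx => ?_⟩
      obtain ⟨y, hyx, hy⟩ := hf.exists_adj_left (v := x) (j := i + 1) (.inl hx)
      obtain ⟨z, hz⟩ := hf.surjective i
      have h₁ := ih.2 y hy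
      have h₂ := ih.1 z hz
      have h₃ : f (g • x) ≠ f (g • z) := fun h => by
        have := (hf.smul_congr g).1 h
        omega
      have h₄ : f (g • x) = f (g • y) + 1 ∨ f (g • y) = f (g • x) + 1 :=
        hf.map_adj ((Aut.adj_smul_iff g).2 hyx)
      omega
    | pred i ih =>
      refine ⟨fun x hx => ?_, fun x hx => by rw [ih.1 x (by omega)]; ring⟩
      obtain ⟨y, hyx, hy⟩ := hf.exists_adj_left (v := x) (j := -i) (.inr (by omega))
      obtain ⟨z, hz⟩ := hf.surjective (-i + 1)
      have h₁ := ih.1 y hy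
      have h₂ := ih.2 z hz
      have h₃ : f (g • x) ≠ f (g • z) := fun h => by
        have := (hf.smul_congr g).1 h
        omega
      have h₄ : f (g • x) = f (g • y) + 1 ∨ f (g • y) = f (g • x) + 1 :=
        hf.map_adj ((Aut.adj_smul_iff g).2 hyx)
      omega
  have hg : ∀ x, f (g • x) = 1 - f x := fun x => (hstep (f x)).1 x rfl
  have hset : g • {v | 1 ≤ f v} = {v | 1 ≤ f v}ᶜ := by
    ext x
    have := hg (g⁻¹ • x)
    rw [smul_inv_smul] at this
    simp only [Set.mem_smul_set_iff_inv_smul_mem, Set.mem_ofPred_eq, Set.mem_compl_iff]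
    omega
  have hswap : ∀ R : Γ.Ray, ¬ Γ.RayEquiv (g.mapRay R) R := by
    intro R hgR
    rcases R.mem_filter_or_compl_mem_filter (hbd 1) with hmem | hmem
    · have h₁ := hgR.compl_mem_filter (hbd 1) (hset ▸ g.smul_mem_filter_mapRay hmem)
      exact Filter.empty_notMem R.filter (by simpa using Filter.inter_mem hmem h₁)
    · have h₀ := g.smul_mem_filter_mapRay hmem
      rw [Set.smul_set_compl, hset, compl_compl] at h₀
      have h₁ := hgR.mem_filter (hbd 1) h₀
      exact Filter.empty_notMem R.filter (by simpa using Filter.inter_mem h₁ hmem)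
  induction e using Quotient.inductionOn with | _ R
  induction e' using Quotient.inductionOn with | _ S
  rcases hR.rayEquiv_trichotomy (g.mapRay R) S R with h₁ | h₁ | h₁
  · exact ⟨g, Quotient.sound (s := Γ.raySetoid) h₁⟩
  · exact absurd h₁ (hswap R)
  · exact ⟨1, (one_smul _ _).trans (Quotient.sound (s := Γ.raySetoid) (Γ.rayEquiv_symm h₁))⟩

theorem DirectedCase.smul_eq {N : Subgroup Γ.Aut} [N.Normal] (h : Γ.DirectedCase N)
    (hN : Γ.HasFiniteOrbits N) (hends : Γ.TwoEnded) (g : Γ.Aut) (e : Γ.Ends) : g • e = e := by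
  obtain ⟨f, hf⟩ := isomorphic_orbitQuotient_iff.1 h.1
  obtain ⟨R₁, R₂, hR⟩ := hends.exists_endPair
  have hadj : ∀ x y, Γ.underlying.Adj x y → f y = f x + 1 ∨ f x = f y + 1 := by
    intro x y hxy
    exact (underlying_adj_iff.1 hxy).2.imp (fun h => hf.map_adj h) fun h => hf.map_adj h
  have hbd := finite_outerBoundary_setOf_le hadj (hf.finite_fiber hN)
  have hhom : Γ.IsHom directedLine f := fun _ _ h => hf.map_adj h
  obtain ⟨ψ, hψ⟩ := hhom.exists_map_smul hends.1
  have hset : ∀ i, g • {v | i ≤ f v} = {v | i + (ψ g).toAdd ≤ f v} := by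
    intro i
    ext x
    have := hψ g (g⁻¹ • x)
    rw [smul_inv_smul] at this
    simp only [Set.mem_smul_set_iff_inv_smul_mem, Set.mem_ofPred_eq]
    omega
  -- Builds an ascending ray `P` and a descending ray `M`. As `g` translates heights, `R` and its
  -- image lie on the same side, opposite to one of these, so with two ends they must be equivalent.
  choose up hup hup' using fun v => hf.exists_adj_right (v := v) (j := f v + 1) rfl
  choose down hdown hdown' using fun v => hf.exists_adj_left (v := v) (j := f v - 1)
    (show f v = f v - 1 + 1 by ring)
  obtain ⟨v₀, hv₀⟩ := hf.surjective 0
  have hupn : ∀ n : ℕ, f (up^[n] v₀) = n := by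
    intro n
    induction n with
    | zero => exact hv₀
    | succ n ih => rw [Function.iterate_succ_apply', hup', ih]; push_cast; rfl
  have hdownn : ∀ n : ℕ, f (down^[n] v₀) = -n := by
    intro n
    induction n with
    | zero => simpa using hv₀
    | succ n ih => rw [Function.iterate_succ_apply', hdown', ih]; push_cast; ring
  let P : Γ.Ray :=
    { vert n := up^[n] v₀
      inj i j hij := by
        have := congrArg f hij
        simp only [hupn] at this
        exact_mod_cast this
      adj n := by
        rw [Function.iterate_succ_apply']
        refine underlying_adj_iff.2 ⟨fun h => ?_, .inl (hup _)⟩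
        have := hup' (up^[n] v₀)
        rw [← h] at this
        omega }
  let M : Γ.Ray :=
    { vert n := down^[n] v₀
      inj i j hij := by
        have := congrArg f hij
        simp only [hdownn] at this
        omega
      adj n := by
        rw [Function.iterate_succ_apply']
        refine underlying_adj_iff.2 ⟨fun h => ?_, .inr (hdown _)⟩
        have := hdown' (down^[n] v₀)
        rw [← h] at this
        omega }
  have hP : ∀ i : ℤ, {v | i ≤ f v} ∈ P.filter := fun i =>
    Ray.mem_filter.2 ⟨i.toNat, fun m hm => by
      change i ≤ f (up^[m] v₀)
      rw [hupn]
      omega⟩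
  have hM : ∀ i : ℤ, {v | i ≤ f v}ᶜ ∈ M.filter := fun i =>
    Ray.mem_filter.2 ⟨(-i + 1).toNat, fun m hm => by
      change ¬ i ≤ f (down^[m] v₀)
      rw [hdownn]
      omega⟩
  induction e using Quotient.inductionOn with | _ R
  refine Quotient.sound (s := Γ.raySetoid) ?_
  have hcon : ∀ {S : Γ.Ray} {A : Set V}, A ∈ S.filter → Aᶜ ∈ S.filter → False := fun {S A} h₁ h₂ =>
    Filter.empty_notMem S.filter (by simpa using Filter.inter_mem h₁ h₂)
  rcases R.mem_filter_or_compl_mem_filter (hbd 0) with h₀ | h₀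
  · rcases hR.rayEquiv_trichotomy (g.mapRay R) R M with h₁ | h₁ | h₁
    · exact h₁
    · have h₂ := h₁.mem_filter (hbd _) (hset 0 ▸ g.smul_mem_filter_mapRay h₀)
      exact (hcon h₂ (hM _)).elim
    · exact (hcon (h₁.mem_filter (hbd 0) h₀) (hM 0)).elim
  · rcases hR.rayEquiv_trichotomy (g.mapRay R) R P with h₁ | h₁ | h₁
    · exact h₁
    · have h₂ := g.smul_mem_filter_mapRay h₀
      rw [Set.smul_set_compl, hset] at h₂
      exact (hcon (hP _) (h₁.compl_mem_filter (hbd _) h₂)).elim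
    · exact (hcon (hP 0) (h₁.compl_mem_filter (hbd 0) h₀)).elim

end Digraph

theorem lemma7 {V : Type*} (Γ : Digraph V) (hvertex : Γ.VertexTransitive)
    (harc : Γ.ArcTransitive) (hends : Γ.TwoEnded) :
    (∃ (N : Subgroup Γ.Aut) (_ : N.Normal),
      Γ.HasFiniteOrbits N ∧ (Γ.UndirectedCase N ∨ Γ.DirectedCase N)) ∧
    ∀ (N : Subgroup Γ.Aut) [N.Normal],
      Γ.HasFiniteOrbits N → (Γ.UndirectedCase N ∨ Γ.DirectedCase N) →
        (Γ.DirectedCase N → Γ.PropertyZ) ∧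
        (Γ.UndirectedCase N → ¬ Γ.PropertyZ) ∧
        (Γ.KArcTransitive 2 → Γ.DirectedCase N) ∧
        (Γ.UndirectedCase N → ∀ e e' : Γ.Ends, ∃ g : Γ.Aut, g • e = e') ∧
        (Γ.DirectedCase N → ∀ (g : Γ.Aut) (e : Γ.Ends), g • e = e) := by
  refine ⟨Digraph.exists_undirectedCase_or_directedCase hvertex harc hends, fun N _ hN hcase =>
    ⟨fun h => h.propertyZ hends.1, fun h => h.not_propertyZ hN hvertex, fun h2 => ?_,
      fun h => h.exists_smul_eq hN harc hends, fun h => h.smul_eq hN hends⟩⟩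
  exact hcase.resolve_left fun h => h.not_kArcTransitive h2
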